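/- Let $M,N,K,L\ge 1$ be integers with $K\ge M$. A base station with $M$ transmit and $N$ receive antennas serves $M$ users with $K$ antennas each. Let $R\in\mathbb{C}^{M\times M}$ be Hermitian positive definite with eigendecomposition $R=U\,\mathrm{diag}(\lambda_1,\dots,\lambda_M)\,U^{\mathsf H}$, $U$ unitary. Let $S\in\mathbb{C}^{M\times L}$ be the matrix of data streams, with $L^{-1}SS^{\mathsf H}=I_M$. For a power allocation $q=(q_1,\dots,q_M)$, $q_m\ge 0$, let the precoder be $W=U\,\mathrm{diag}(\sqrt{q_1},\dots,\sqrt{q_M})$ and the transmitted signal $X=WS$. Sensing: the echo is $Y=GX+N_{\mathrm s}$, where the rows of $G\in\mathbb{C}^{N\times M}$ are $g_1^{\mathsf H},\dots,g_N^{\mathsf H}$ with $g_n\sim\mathcal{CN}(0,R)$ independent, and $N_{\mathrm s}$ is independent of $G$ with i.i.d. $\mathcal{CN}(0,1)$ entries. The sensing rate (SR) is $\mathcal R_{\mathrm s}(q)=L^{-1}I(Y;G\mid X)$, in bits. Communication: the entries of each channel matrix $H_m\in\mathbb{C}^{K\times M}$ are i.i.d. $\mathcal{CN}(0,1)$. User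 $m$ uses the normalized zero-forcing equalizer $v_m=a_m/\lVert a_m\rVert$, where $a_m$ is the $m$-th column of $A_m(A_m^{\mathsf H}A_m)^{-1}$, $A_m=H_mU$. The sum communication rate (CR) is $\mathcal R_{\mathrm c}(q)=\sum_{m=1}^M\log_2\bigl(1+q_m|v_m^{\mathsf H}H_mu_m|^2\bigr)$, with $u_m$ the $m$-th column of $U$. Fix $\alpha\in[0,1]$. For each power budget $p>0$ and each channel realization, let $q$ be the optimal power allocation in the rate-profile problem $$\max_{q,\,r}\ r\quad\text{s.t.}\quad \mathcal R_{\mathrm s}(q)\ge\alpha r,\quad \mathcal R_{\mathrm c}(q)\ge(1-\alpha)r,\quad \sum_{m=1}^M q_m\le p,\quad q_m\ge 0 .$$ It is almost surely unique, and the SR and CR that it achieves are integrable. Let $\mathcal R_{\mathrm s}^\alpha$ and $\mathcal R_{\mathrm c}^\alpha$ be the expectations over the channels of this SR and CR. Then, as $p\to\infty$, $$\mathcal R_{\mathrm s}^\alpha=\frac{NM}{L}\Bigl(\log_2 p+\frac1M\sum_{m=1}^M\log_2\frac{L\lambda_m}{M}\Bigr)+o(1),$$ $$\mathcal R_{\mathrm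 c}^\alpha=M\Bigl(\log_2 p-\log_2 M+\frac{\psi(K-M+1)}{\ln 2}\Bigr)+o(1),$$ where $\psi(x)=\frac{\mathrm d}{\mathrm dx}\ln\Gamma(x)$ is the digamma function. -/

import Mathlib

open MeasureTheory ProbabilityTheory Filter Topology
open scoped Matrix ComplexOrder MatrixOrder ENNReal NNReal

noncomputable section

namespace ISAC

/-! ### Complex Gaussian laws -/

/-- The standard complex Gaussian law `CN(0, 1)`: real and imaginary parts are independent
real Gaussians with mean `0` and variance `1/2`. -/
def stdCN : Measure ℂ :=
  ((gaussianReal 0 (1 / 2)).prod (gaussianReal 0 (1 / 2))).map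
    (fun x : ℝ × ℝ => (⟨x.1, x.2⟩ : ℂ))

/-- The circularly symmetric complex Gaussian law `CN(0, R)` on `ℂ ^ M`: the law of `R ^ (1/2) z`
with `z` a vector of independent `CN(0, 1)` entries. -/
def vecCN {M : ℕ} (R : Matrix (Fin M) (Fin M) ℂ) : Measure (Fin M → ℂ) :=
  (Measure.pi fun _ : Fin M => stdCN).map (fun z => CFC.sqrt R *ᵥ z)

/-! ### Sensing rate -/

/-- Mutual information (in nats) of a pair with joint law `μ`: the Kullback-Leibler divergence of
the joint law from the product of its marginals. -/
def mutualInfo {α β : Type*} [MeasurableSpace α] [MeasurableSpace β] (μ : Measure (α × β)) :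
    ℝ≥0∞ :=
  InformationTheory.klDiv μ ((μ.map Prod.fst).prod (μ.map Prod.snd))

/-- Law of the `N × M` target response matrix `G`, whose rows are `g_nᴴ` with independent
`g_n ∼ CN(0, R)`. -/
def targetLaw (N : ℕ) {M : ℕ} (R : Matrix (Fin M) (Fin M) ℂ) : Measure (Fin N → Fin M → ℂ) :=
  (Measure.pi fun _ : Fin N => vecCN R).map (fun g n m => star (g n m))

/-- Law of the `N × L` noise matrix: independent `CN(0, 1)` entries. -/
def noiseLaw (N L : ℕ) : Measure (Fin N → Fin L → ℂ) :=
  Measure.pi fun _ : Fin N => Measure.pi fun _ : Fin L => stdCN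

/-- Joint law of `(Y, G)`, where `Y = G X + N_s` is the echo of the transmitted signal matrix `X`,
with `G` and `N_s` independent. -/
def echoLaw (N : ℕ) {M L : ℕ} (R : Matrix (Fin M) (Fin M) ℂ) (X : Matrix (Fin M) (Fin L) ℂ) :
    Measure ((Fin N → Fin L → ℂ) × (Fin N → Fin M → ℂ)) :=
  ((targetLaw N R).prod (noiseLaw N L)).map
    (fun x => (fun n l => (Matrix.of x.1 * X) n l + x.2 n l, x.1))

/-- The sensing rate `L⁻¹ I(Y; G | X)` in bits, given the transmitted signal matrix `X`. -/
def sensingRate (N : ℕ) {M L : ℕ} (R : Matrix (Fin M) (Fin M) ℂ)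
    (X : Matrix (Fin M) (Fin L) ℂ) : ℝ :=
  (L : ℝ)⁻¹ * ((mutualInfo (echoLaw N R X)).toReal / Real.log 2)

/-- The precoding matrix `P diag(√q_1, …, √q_M)`. -/
def precoder {M : ℕ} (P : Matrix (Fin M) (Fin M) ℂ) (q : Fin M → ℝ) :
    Matrix (Fin M) (Fin M) ℂ :=
  P * Matrix.diagonal (fun m => ((Real.sqrt (q m) : ℝ) : ℂ))

/-- Sensing rate as a function of the power allocation `q`, for normalized precoders `P` and data
streams `S` (transmitted signal `X = W S`). -/
def SR (N : ℕ) {M L : ℕ} (R P : Matrix (Fin M) (Fin M) ℂ) (S : Matrix (Fin M) (Fin L) ℂ)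
    (q : Fin M → ℝ) : ℝ :=
  sensingRate N R (precoder P q * S)

/-! ### Communication rate -/

/-- The normalized zero-forcing equalizer `v_m` of user `m`: the `m`-th column of
`A (Aᴴ A)⁻¹`, with `A = H_m P` the effective channel, divided by its Euclidean norm. -/
def equalizer {K M : ℕ} (A : Matrix (Fin K) (Fin M) ℂ) (m : Fin M) : Fin K → ℂ :=
  fun k => (A * (Aᴴ * A)⁻¹) k m / ((‖WithLp.toLp 2 (fun i => (A * (Aᴴ * A)⁻¹) i m)‖ : ℝ) : ℂ)

/-- Received signal-to-noise ratio `γ_m = q_m |v_mᴴ H_m p_m|²` of user `m`. -/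
def userSNR {K M : ℕ} (h : Fin M → Matrix (Fin K) (Fin M) ℂ) (P : Matrix (Fin M) (Fin M) ℂ)
    (q : Fin M → ℝ) (m : Fin M) : ℝ :=
  q m * ‖star (equalizer (h m * P) m) ⬝ᵥ (h m *ᵥ fun i => P i m)‖ ^ 2

/-- Sum communication rate `∑ m, log₂ (1 + γ_m)` for the channel realization `h`. -/
def CR {K M : ℕ} (h : Fin M → Matrix (Fin K) (Fin M) ℂ) (P : Matrix (Fin M) (Fin M) ℂ)
    (q : Fin M → ℝ) : ℝ :=
  ∑ m, Real.logb 2 (1 + userSNR h P q m)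

/-! ### The rate-profile problem -/

/-- Feasibility of `(q, r)` in the rate-profile problem: `R_s ≥ α r`, `R_c ≥ (1 - α) r`,
total power at most `p`, nonnegative powers. -/
def Feasible {M : ℕ} (Rs Rc : (Fin M → ℝ) → ℝ) (α p : ℝ) (q : Fin M → ℝ) (r : ℝ) : Prop :=
  α * r ≤ Rs q ∧ (1 - α) * r ≤ Rc q ∧ ∑ m, q m ≤ p ∧ ∀ m, 0 ≤ q m

/-- `q` is an optimal power allocation: together with some `r` it solves the problem of maximizing
`r` over all feasible pairs. -/
def IsOptimal {M : ℕ} (Rs Rc : (Fin M → ℝ) → ℝ) (α p : ℝ) (q : Fin M → ℝ) : Prop :=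
  ∃ r, Feasible Rs Rc α p q r ∧ ∀ q' r', Feasible Rs Rc α p q' r' → r' ≤ r

open Classical in
/-- An optimal power allocation of the rate-profile problem (`0` if there is none). -/
def optimalPower {M : ℕ} (Rs Rc : (Fin M → ℝ) → ℝ) (α p : ℝ) : Fin M → ℝ :=
  if h : ∃ q, IsOptimal Rs Rc α p q then h.choose else 0

/-- The Pareto-optimal power allocation for rate-profile parameter `α`, power budget `p` and
channel realization `h`. -/
def paretoPower (N : ℕ) {K M L : ℕ} (R U : Matrix (Fin M) (Fin M) ℂ)
    (S : Matrix (Fin M) (Fin L) ℂ) (α p : ℝ) (h : Fin M → Matrix (Fin K) (Fin M) ℂ) : Fin M → ℝ :=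
  optimalPower (SR N R U S) (CR h U) α p

/-- The sensing rate achieved by the Pareto-optimal precoder, given the channel. -/
def instSR (N : ℕ) {K M L : ℕ} (R U : Matrix (Fin M) (Fin M) ℂ)
    (S : Matrix (Fin M) (Fin L) ℂ) (α p : ℝ) (h : Fin M → Matrix (Fin K) (Fin M) ℂ) : ℝ :=
  SR N R U S (paretoPower N R U S α p h)

/-- The sum communication rate achieved by the Pareto-optimal precoder, given the channel. -/
def instCR (N : ℕ) {K M L : ℕ} (R U : Matrix (Fin M) (Fin M) ℂ)
    (S : Matrix (Fin M) (Fin L) ℂ) (α p : ℝ) (h : Fin M → Matrix (Fin K) (Fin M) ℂ) : ℝ :=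
  CR h U (paretoPower N R U S α p h)

/-- The digamma function `ψ(x) = d/dx ln Γ(x)` on the reals. -/
def digamma (x : ℝ) : ℝ := deriv (fun y => Real.log (Real.Gamma y)) x

end ISAC

end

namespace ISAC

/-! ### Standard complex Gaussian vectors -/

/-! Both rates are sum rates of parallel Gaussian channels, and at high power every allocation that
is not beaten in both rates by the uniform one is nearly uniform. The limits are therefore those of
the uniform allocation, whatever `α` is.

Sensing. The precoder diagonalizes `R` and the rows of `S` are orthogonal, so matched filtering
splits each receive antenna into `M` scalar channels of gain `L λ_m`. Explicit Gaussian densities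
then give the mutual information, and `SR_eq` says `SR = (N / L) ∑ log₂ (1 + L λ_m q_m)`.

Communication. The zero-forcing gain `c_m` is the squared distance of one column of `H_m U` from the
span of the other `M - 1` columns (`zfGain_eq_norm_proj`). By unitary invariance of the Gaussian law
it is `Gamma(K - M + 1, 1)` distributed (`hasLaw_zfGain`), and the mean of its logarithm is `ψ(K - M
+ 1)` (`integral_log_gammaMeasure`).

Optimality. The uniform allocation `p / M` is feasible, so it cannot beat an optimal `q` strictly in
both rates (`IsOptimal.le_or_le`). Hence `q` does at least as well as uniform in one of the two sum
rates. By concavity of the logarithm either alternative forces `q_m / p → 1 / M`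
(`sq_sqrt_sub_one_le`), so `log (1 + d_m q_m) - log p → log (d_m / M)` for every family of gains
`d`. The convergence is dominated by integrable logarithms of the gains, which lets it pass to
expectations (`tendsto_integral_log_rate`).

Measurability. The allocation in the statement is picked by choice. Strict concavity makes it almost
surely unique, so it agrees almost everywhere with a continuous function of the log-gains
(`exists_continuous_isOptimal`). -/

instance : IsProbabilityMeasure stdCN := by
  unfold stdCN
  refine Measure.isProbabilityMeasure_map ?_
  exact (Complex.measurableEquivRealProd.symm.measurable).aemeasurable

theorem map_withDensity_comp {α β : Type*} [MeasurableSpace α] [MeasurableSpace β]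
    {μ : Measure α} {ν : Measure β} {g : α → β} (hg : MeasurePreserving g μ ν)
    {f : β → ℝ≥0∞} (hf : Measurable f) :
    (μ.withDensity (fun x => f (g x))).map g = ν.withDensity f := by
  ext s hs
  rw [Measure.map_apply hg.measurable hs, withDensity_apply _ (hg.measurable hs),
    withDensity_apply _ hs, hg.setLIntegral_comp_preimage hs hf]

theorem stdCN_eq_withDensity :
    stdCN = volume.withDensity
      (fun z : ℂ => ENNReal.ofReal (Real.pi⁻¹ * Real.exp (-‖z‖ ^ 2))) := by
  have h := Complex.volume_preserving_equiv_real_prod.symm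
  have hf : Measurable
      (fun z : ℂ => ENNReal.ofReal (Real.pi⁻¹ * Real.exp (-‖z‖ ^ 2))) := by fun_prop
  rw [← map_withDensity_comp h hf]
  unfold stdCN
  rw [gaussianReal_of_var_ne_zero _ (by norm_num), prod_withDensity (by fun_prop) (by fun_prop)]
  congr 1
  · rw [Measure.volume_eq_prod]
    congr 1
    funext x
    rw [gaussianPDF, gaussianPDF, ← ENNReal.ofReal_mul (gaussianPDFReal_nonneg _ _ _)]
    congr 1
    simp only [gaussianPDFReal]
    have : ‖Complex.measurableEquivRealProd.symm x‖ ^ 2 = x.1 ^ 2 + x.2 ^ 2 := by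
      rw [← Complex.normSq_eq_norm_sq, Complex.normSq_apply]
      simp [Complex.measurableEquivRealProd]; ring
    rw [this]
    have h2 : (2 * Real.pi * ((1 / 2 : ℝ≥0) : ℝ)) = Real.pi := by push_cast; ring
    rw [h2]
    have h3 : (√Real.pi)⁻¹ * (√Real.pi)⁻¹ = Real.pi⁻¹ := by
      rw [← mul_inv, Real.mul_self_sqrt Real.pi_pos.le]
    have h4 : Real.exp (-(x.1 - 0) ^ 2 / (2 * ((1 / 2 : ℝ≥0) : ℝ)))
        * Real.exp (-(x.2 - 0) ^ 2 / (2 * ((1 / 2 : ℝ≥0) : ℝ)))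
        = Real.exp (-(x.1 ^ 2 + x.2 ^ 2)) := by
      rw [← Real.exp_add]; congr 1; push_cast; ring
    rw [← h3, ← h4]; ring

/-- The law of a vector of independent `CN(0, 1)` entries. -/
noncomputable abbrev iidCN (ι : Type*) [Fintype ι] : Measure (ι → ℂ) := Measure.pi fun _ : ι => stdCN

theorem integrable_stdCN_density :
    Integrable (fun z : ℂ => Real.pi⁻¹ * Real.exp (-‖z‖ ^ 2)) := by
  refine ⟨by fun_prop, ?_⟩
  rw [hasFiniteIntegral_iff_ofReal (ae_of_all _ fun z => by positivity)]
  have h : stdCN Set.univ = 1 := measure_univ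
  rw [stdCN_eq_withDensity, withDensity_apply _ MeasurableSet.univ, setLIntegral_univ] at h
  rw [h]; exact ENNReal.one_lt_top

theorem withDensity_ofReal_apply {F : Type*} [MeasureSpace F] {g : F → ℝ} {s : Set F}
    (hg : Integrable g) (hg0 : ∀ x, 0 ≤ g x) (hs : MeasurableSet s) :
    (volume : Measure F).withDensity (fun x => ENNReal.ofReal (g x)) s
      = ENNReal.ofReal (∫ x, s.indicator g x) := by
  rw [withDensity_apply _ hs, integral_indicator hs,
    ofReal_integral_eq_lintegral_ofReal hg.integrableOn (ae_of_all _ hg0)]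

/-- It suffices to compare the measures on boxes, where the indicator of the box times the product
density is again a product and the integral factors. -/
theorem pi_withDensity_ofReal {ι E : Type*} [Fintype ι] [MeasureSpace E]
    [SigmaFinite (volume : Measure E)] {f : E → ℝ} (hf : Integrable f) (h0 : ∀ x, 0 ≤ f x) :
    (Measure.pi fun _ : ι => (volume : Measure E).withDensity (fun x => ENNReal.ofReal (f x)))
      = (volume : Measure (ι → E)).withDensity (fun x => ENNReal.ofReal (∏ i, f (x i))) := by
  have : ∀ i : ι, SigmaFinite
      ((volume : Measure E).withDensity (fun x => ENNReal.ofReal (f x))) := fun i =>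
    inferInstance
  refine Measure.pi_eq ?_
  intro s hs
  have hF : Integrable (fun x : ι → E => ∏ i, f (x i)) :=
    Integrable.fintype_prod (f := fun _ => f) (fun _ => hf)
  have hind : (Set.univ.pi s).indicator (fun x : ι → E => ∏ i, f (x i))
      = fun x => ∏ i, (s i).indicator f (x i) := by
    funext x
    by_cases hx : x ∈ Set.univ.pi s
    · rw [Set.indicator_of_mem hx]
      refine Finset.prod_congr rfl fun i _ => ?_
      rw [Set.indicator_of_mem (hx i (Set.mem_univ i))]
    · rw [Set.indicator_of_notMem hx]
      simp only [Set.mem_pi, Set.mem_univ, true_implies, not_forall] at hx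
      obtain ⟨i, hi⟩ := hx
      exact (Finset.prod_eq_zero (Finset.mem_univ i) (Set.indicator_of_notMem hi f)).symm
  rw [withDensity_ofReal_apply hF (fun x => Finset.prod_nonneg fun i _ => h0 _) (MeasurableSet.univ_pi hs), hind,
    integral_fintype_prod_volume_eq_prod (f := fun i x => (s i).indicator f x),
    ENNReal.ofReal_prod_of_nonneg fun i _ => integral_nonneg fun x =>
      Set.indicator_nonneg (fun x _ => h0 x) x]
  refine Finset.prod_congr rfl fun i _ => ?_
  rw [withDensity_ofReal_apply hf h0 (hs i)]

theorem iidCN_eq_withDensity (ι : Type*) [Fintype ι] :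
    iidCN ι = (volume : Measure (ι → ℂ)).withDensity (fun z => ENNReal.ofReal
      ((Real.pi⁻¹) ^ Fintype.card ι * Real.exp (-∑ i, ‖z i‖ ^ 2))) := by
  unfold iidCN
  rw [stdCN_eq_withDensity,
    pi_withDensity_ofReal integrable_stdCN_density (fun z => by positivity)]
  congr 1
  funext z
  rw [Finset.prod_mul_distrib, Finset.prod_const, ← Real.exp_sum, Finset.sum_neg_distrib,
    Finset.card_univ]

/-- Lets Lebesgue-null sets, such as proper subspaces, be discarded under the Gaussian law. -/
theorem volume_absolutelyContinuous_iidCN (ι : Type*) [Fintype ι] :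
    iidCN ι ≪ (volume : Measure (ι → ℂ)) := by
  rw [iidCN_eq_withDensity]; exact withDensity_absolutelyContinuous _ _

/-- The law of an i.i.d. `CN(0, 1)` vector is invariant under linear isometries. -/
theorem map_iidCN_of_isometry {ι : Type*} [Fintype ι] (f : (ι → ℂ) ≃ₗ[ℝ] (ι → ℂ))
    (hf : ∀ z, ∑ i, ‖f z i‖ ^ 2 = ∑ i, ‖z i‖ ^ 2) :
    (iidCN ι).map f = iidCN ι := by
  have hfm : Measurable f := (f.toContinuousLinearEquiv.continuous).measurable
  have : (Measure.map f (volume : Measure (ι → ℂ))).IsAddHaarMeasure :=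
    f.toContinuousLinearEquiv.isAddHaarMeasure_map volume
  -- Uniqueness of Haar measure replaces a determinant computation: the density is invariant under
  -- `f`, and total mass one forces `c = 1`.
  obtain ⟨c, hc⟩ : ∃ c : ℝ≥0, Measure.map f (volume : Measure (ι → ℂ)) = c • volume :=
    ⟨_, Measure.isAddLeftInvariant_eq_smul _ _⟩
  set d : (ι → ℂ) → ℝ≥0∞ := fun z => ENNReal.ofReal
      ((Real.pi⁻¹) ^ Fintype.card ι * Real.exp (-∑ i, ‖z i‖ ^ 2)) with hd
  have hdm : Measurable d := by fun_prop
  have hdf : d = fun z => d (f z) := by funext z; simp only [hd, hf]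
  have h1 : (iidCN ι).map f = c • iidCN ι := by
    rw [iidCN_eq_withDensity]
    change (volume.withDensity d).map f = c • volume.withDensity d
    conv_lhs => rw [hdf]
    rw [map_withDensity_comp ⟨hfm, rfl⟩ hdm, hc]
    exact withDensity_smul_measure _ _
  have h2 : ((iidCN ι).map f) Set.univ = 1 := by
    rw [Measure.map_apply hfm MeasurableSet.univ, Set.preimage_univ, measure_univ]
  rw [h1, Measure.smul_apply, measure_univ] at h2
  have h3 : c = 1 := by
    simpa [ENNReal.smul_def] using h2
  rw [h1, h3, one_smul]

theorem sum_norm_sq_mulVec {ι : Type*} [Fintype ι] [DecidableEq ι] {U : Matrix ι ι ℂ}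
    (hU : U ∈ Matrix.unitaryGroup ι ℂ) (z : ι → ℂ) :
    ∑ i, ‖(U *ᵥ z) i‖ ^ 2 = ∑ i, ‖z i‖ ^ 2 := by
  have h : ∀ w : ι → ℂ, ((∑ i, ‖w i‖ ^ 2 : ℝ) : ℂ) = star w ⬝ᵥ w := by
    intro w
    simp only [dotProduct, Pi.star_apply, RCLike.star_def, Complex.conj_mul']
    push_cast; rfl
  have h2 : star (U *ᵥ z) ⬝ᵥ (U *ᵥ z) = star z ⬝ᵥ z := by
    rw [Matrix.star_mulVec, Matrix.dotProduct_mulVec, Matrix.vecMul_vecMul,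
      ← Matrix.star_eq_conjTranspose, Matrix.mem_unitaryGroup_iff'.1 hU, Matrix.vecMul_one]
  rw [← h, ← h] at h2
  exact_mod_cast h2

theorem map_iidCN_mulVec {ι : Type*} [Fintype ι] [DecidableEq ι] {U : Matrix ι ι ℂ}
    (hU : U ∈ Matrix.unitaryGroup ι ℂ) :
    (iidCN ι).map (fun z => U *ᵥ z) = iidCN ι := by
  let f : (ι → ℂ) ≃ₗ[ℂ] (ι → ℂ) := Matrix.toLin'OfInv
    (Matrix.mem_unitaryGroup_iff'.1 hU) (Matrix.mem_unitaryGroup_iff.1 hU)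
  exact map_iidCN_of_isometry (f.restrictScalars ℝ) (sum_norm_sq_mulVec hU)

theorem iidCN_map_curry (ι κ : Type*) [Fintype ι] [Fintype κ] :
    (iidCN (ι × κ)).map (fun z i j => z (i, j)) = Measure.pi fun _ : ι => iidCN κ := by
  have := Measure.infinitePi_map_curry (fun (_ : ι) (_ : κ) => stdCN)
  simp only [Measure.infinitePi_eq_pi] at this
  exact this

/-- Translating an i.i.d. `CN(0, 1)` vector: the Cameron-Martin density. -/
theorem lintegral_iidCN_add {ι : Type*} [Fintype ι] (x : ι → ℂ) {F : (ι → ℂ) → ℝ≥0∞}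
    (hF : Measurable F) :
    ∫⁻ z, F (x + z) ∂(iidCN ι) = ∫⁻ y, ENNReal.ofReal
      (Real.exp (2 * (∑ i, y i * star (x i)).re - ∑ i, ‖x i‖ ^ 2)) * F y ∂(iidCN ι) := by
  rw [iidCN_eq_withDensity, lintegral_withDensity_eq_lintegral_mul _ (by fun_prop) (by fun_prop),
    lintegral_withDensity_eq_lintegral_mul _ (by fun_prop) (by fun_prop)]
  -- Only the integral over `y` should be shifted, to `y = x + z`; the shift put here on the other
  -- integral is undone below.
  rw [← lintegral_add_left_eq_self _ x]
  symm
  rw [← lintegral_add_left_eq_self _ x]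
  symm
  rw [lintegral_add_left_eq_self
    (fun z => ((fun z : ι → ℂ => ENNReal.ofReal
      ((Real.pi⁻¹) ^ Fintype.card ι * Real.exp (-∑ i, ‖z i‖ ^ 2))) * fun z => F (x + z)) z) x]
  refine lintegral_congr fun z => ?_
  simp only [Pi.mul_apply]
  rw [← mul_assoc, ← ENNReal.ofReal_mul (by positivity), mul_assoc ((Real.pi⁻¹) ^ _),
    ← Real.exp_add]
  congr 4
  have : ∀ i, ‖(x + z) i‖ ^ 2 = 2 * ((x + z) i * star (x i)).re - ‖x i‖ ^ 2 + ‖z i‖ ^ 2 := by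
    intro i
    simp only [← Complex.normSq_eq_norm_sq, Complex.normSq_apply, Pi.add_apply, RCLike.star_def,
      Complex.mul_re, Complex.add_re, Complex.add_im, Complex.conj_re, Complex.conj_im]
    ring
  simp only [this, Finset.sum_add_distrib, Finset.sum_sub_distrib, Complex.re_sum, Finset.mul_sum]
  ring

/-! ### Moments of complex Gaussian vectors -/

/-- The density is even, so the mean equals its own negative. -/
theorem integral_id_stdCN : ∫ z, z ∂stdCN = 0 := by
  have hmp : MeasurePreserving (Neg.neg : ℂ → ℂ) stdCN stdCN := by
    refine ⟨measurable_neg, ?_⟩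
    have hd : Measurable
        (fun z : ℂ => ENNReal.ofReal (Real.pi⁻¹ * Real.exp (-‖z‖ ^ 2))) := by fun_prop
    have := map_withDensity_comp (Measure.measurePreserving_neg (volume : Measure ℂ)) hd
    simp only [norm_neg] at this
    rw [stdCN_eq_withDensity]; exact this
  have h := hmp.integral_comp (MeasurableEquiv.neg ℂ).measurableEmbedding (fun z : ℂ => z)
  rw [integral_neg] at h
  exact CharZero.eq_neg_self_iff.mp h.symm

theorem integrable_sq_gaussianReal (v : ℝ≥0) : Integrable (fun x : ℝ => x ^ 2) (gaussianReal 0 v) :=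
  (memLp_id_gaussianReal 2).integrable_sq

theorem integral_sq_gaussianReal (v : ℝ≥0) : ∫ x, x ^ 2 ∂(gaussianReal 0 v) = v := by
  have h := variance_id_gaussianReal (μ := 0) (v := v)
  rw [variance_of_integral_eq_zero (by fun_prop) (by simp)] at h
  simpa using h

theorem norm_sq_mk (x : ℝ × ℝ) : ‖(⟨x.1, x.2⟩ : ℂ)‖ ^ 2 = x.1 ^ 2 + x.2 ^ 2 := by
  rw [← Complex.normSq_eq_norm_sq, Complex.normSq_apply]; ring

theorem measurable_complex_mk : Measurable (fun x : ℝ × ℝ => (⟨x.1, x.2⟩ : ℂ)) :=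
  Complex.measurableEquivRealProd.symm.measurable

theorem integrable_norm_sq_stdCN : Integrable (fun z : ℂ => ‖z‖ ^ 2) stdCN := by
  unfold stdCN
  rw [integrable_map_measure (by fun_prop) measurable_complex_mk.aemeasurable]
  simp only [Function.comp_def, norm_sq_mk]
  exact ((integrable_sq_gaussianReal _).comp_fst _).add ((integrable_sq_gaussianReal _).comp_snd _)

theorem integral_norm_sq_stdCN : ∫ z, ‖z‖ ^ 2 ∂stdCN = 1 := by
  unfold stdCN
  rw [integral_map measurable_complex_mk.aemeasurable (by fun_prop)]
  simp only [norm_sq_mk]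
  rw [integral_add ((integrable_sq_gaussianReal _).comp_fst _)
    ((integrable_sq_gaussianReal _).comp_snd _), integral_fun_fst (fun x : ℝ => x ^ 2),
    integral_fun_snd (fun x : ℝ => x ^ 2)]
  simp only [integral_sq_gaussianReal]
  simp; norm_num

theorem memLp_id_stdCN : MemLp (fun z : ℂ => z) 2 stdCN :=
  (memLp_two_iff_integrable_sq_norm (by fun_prop)).2 integrable_norm_sq_stdCN

section
variable {ι : Type*} [Fintype ι]

theorem memLp_eval_iidCN (i : ι) : MemLp (fun z : ι → ℂ => z i) 2 (iidCN ι) :=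
  memLp_id_stdCN.comp_measurePreserving (measurePreserving_eval (fun _ : ι => stdCN) i)

theorem integral_eval_iidCN (i : ι) : ∫ z, z i ∂(iidCN ι) = 0 := by
  rw [integral_comp_eval (μ := fun _ : ι => stdCN) (f := fun z : ℂ => z) (by fun_prop),
    integral_id_stdCN]

theorem integral_norm_sq_eval_iidCN (i : ι) : ∫ z, ‖z i‖ ^ 2 ∂(iidCN ι) = 1 := by
  rw [integral_comp_eval (μ := fun _ : ι => stdCN) (f := fun z : ℂ => ‖z‖ ^ 2) (by fun_prop),
    integral_norm_sq_stdCN]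

theorem integral_eval_mul_star_iidCN {i j : ι} (h : i ≠ j) :
    ∫ z, z i * star (z j) ∂(iidCN ι) = 0 := by
  have hi := (iIndepFun_pi (μ := fun _ : ι => stdCN) (X := fun _ => (id : ℂ → ℂ))
    (fun _ => aemeasurable_id)).indepFun h
  have h2 : IndepFun (fun z : ι → ℂ => z i) (fun z : ι → ℂ => star (z j)) (iidCN ι) :=
    hi.comp measurable_id continuous_star.measurable
  rw [h2.integral_fun_mul_eq_mul_integral (memLp_eval_iidCN i).1 (memLp_eval_iidCN j).star.1, integral_eval_iidCN,
    zero_mul]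

theorem memLp_linear_iidCN (c : ι → ℂ) : MemLp (fun z : ι → ℂ => ∑ i, c i * z i) 2 (iidCN ι) :=
  memLp_finsetSum _ fun i _ => (memLp_eval_iidCN i).const_mul (c i)

/-- The second moment of a linear functional of an i.i.d. `CN(0, 1)` vector. -/
theorem integral_norm_sq_linear_iidCN (c : ι → ℂ) :
    ∫ z, ‖∑ i, c i * z i‖ ^ 2 ∂(iidCN ι) = ∑ i, ‖c i‖ ^ 2 := by
  classical
  have hexp : ∀ z : ι → ℂ, ((‖∑ i, c i * z i‖ ^ 2 : ℝ) : ℂ)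
      = ∑ i, ∑ j, (c i * star (c j)) * (z i * star (z j)) := by
    intro z
    rw [Complex.ofReal_pow, ← Complex.mul_conj', map_sum, Finset.sum_mul_sum]
    refine Finset.sum_congr rfl fun i _ => Finset.sum_congr rfl fun j _ => ?_
    simp only [map_mul, RCLike.star_def]; ring
  have hint : ∀ i j, Integrable (fun z : ι → ℂ => (c i * star (c j)) * (z i * star (z j)))
      (iidCN ι) := fun i j =>
    ((memLp_eval_iidCN i).integrable_mul (memLp_eval_iidCN j).star).const_mul _
  have : ((∫ z, ‖∑ i, c i * z i‖ ^ 2 ∂(iidCN ι) : ℝ) : ℂ) = ((∑ i, ‖c i‖ ^ 2 : ℝ) : ℂ) := by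
    rw [← integral_complex_ofReal]
    simp only [hexp]
    rw [integral_finsetSum _ fun i _ => integrable_finsetSum _ fun j _ => hint i j]
    push_cast
    refine Finset.sum_congr rfl fun i _ => ?_
    rw [integral_finsetSum _ fun j _ => hint i j, Finset.sum_eq_single i]
    · rw [integral_const_mul]
      have : ∀ z : ι → ℂ, z i * star (z i) = ((‖z i‖ ^ 2 : ℝ) : ℂ) := fun z => by
        rw [RCLike.star_def, Complex.mul_conj']; push_cast; rfl
      simp only [this]
      rw [integral_complex_ofReal, integral_norm_sq_eval_iidCN]
      simp
    · intro j _ hj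
      rw [integral_const_mul, integral_eval_mul_star_iidCN hj.symm, mul_zero]
    · simp
  exact_mod_cast this

end

theorem lintegral_pi_prod {ι E : Type*} [Fintype ι] [MeasurableSpace E] (μ : ι → Measure E)
    [∀ i, IsProbabilityMeasure (μ i)] {f : ι → E → ℝ≥0∞} (hf : ∀ i, Measurable (f i)) :
    ∫⁻ x, ∏ i, f i (x i) ∂(Measure.pi μ) = ∏ i, ∫⁻ x, f i x ∂(μ i) := by
  rw [lintegral_prod_eq_prod_lintegral_of_indepFun Finset.univ (fun i (x : ι → E) => f i (x i))
    (iIndepFun_pi (X := f) fun i => (hf i).aemeasurable) (fun i => by fun_prop)]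
  refine Finset.prod_congr rfl fun i _ => ?_
  exact (measurePreserving_eval μ i).lintegral_comp (hf i)

/-- A Gaussian integral: the exponential of a quadratic plus a linear form under `CN(0, 1)`. -/
theorem lintegral_exp_stdCN (a : ℂ) {s : ℝ} (hs : 0 ≤ s) :
    ∫⁻ w, ENNReal.ofReal (Real.exp (2 * (a * w).re - s * ‖w‖ ^ 2)) ∂stdCN
      = ENNReal.ofReal (Real.exp (‖a‖ ^ 2 / (1 + s) - Real.log (1 + s))) := by
  have hs1 : (0 : ℝ) < 1 + s := by linarith
  set t : ℝ := √(1 + s) with ht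
  have htp : 0 < t := Real.sqrt_pos.2 hs1
  have ht2 : t ^ 2 = 1 + s := Real.sq_sqrt hs1.le
  set D : ℂ → ℝ≥0∞ := fun z => ENNReal.ofReal (Real.pi⁻¹ * Real.exp (-‖z‖ ^ 2)) with hD
  have hDm : Measurable D := by fun_prop
  have hone : ∫⁻ z, D z = 1 := by
    have h : stdCN Set.univ = 1 := measure_univ
    rwa [stdCN_eq_withDensity, withDensity_apply _ MeasurableSet.univ, setLIntegral_univ] at h
  have hscale : ∫⁻ z : ℂ, D (t • z) = ENNReal.ofReal (1 + s)⁻¹ := by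
    have h1 : ∫⁻ z : ℂ, D (t • z) = ∫⁻ z, D z ∂(Measure.map (t • ·) (volume : Measure ℂ)) :=
      (lintegral_map hDm (measurable_const_smul t)).symm
    rw [h1, Measure.map_addHaar_smul _ htp.ne', lintegral_smul_measure, hone,
      Complex.finrank_real_complex, ht2, abs_of_pos (inv_pos.2 hs1)]
    simp
  -- Completing the square: the exponent is a Gaussian centred at `ā / (1 + s)` and scaled by `t =
  -- √(1 + s)`. As `ℂ` has real dimension two, the Jacobian contributes `(1 + s)⁻¹`.
  set b : ℂ := (t⁻¹ * t⁻¹ : ℝ) * star a with hb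
  have hpt : ∀ w : ℂ, Real.pi⁻¹ * Real.exp (-‖w‖ ^ 2) * Real.exp (2 * (a * w).re - s * ‖w‖ ^ 2)
      = Real.exp (‖a‖ ^ 2 / (1 + s)) * (Real.pi⁻¹ * Real.exp (-‖t • (w - b)‖ ^ 2)) := by
    intro w
    rw [mul_assoc, ← Real.exp_add, mul_left_comm, ← Real.exp_add]
    congr 2
    rw [norm_smul, mul_pow, Real.norm_eq_abs, sq_abs, ht2]
    have hinv : t⁻¹ * t⁻¹ = (1 + s)⁻¹ := by rw [← ht2]; field_simp
    rw [hb, hinv]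
    simp only [← Complex.normSq_eq_norm_sq, Complex.normSq_apply, RCLike.star_def,
      Complex.mul_re, Complex.mul_im, Complex.sub_re, Complex.sub_im, Complex.conj_re,
      Complex.conj_im, Complex.ofReal_re, Complex.ofReal_im]
    field_simp
    ring
  rw [stdCN_eq_withDensity, lintegral_withDensity_eq_lintegral_mul _ hDm (by fun_prop)]
  have : ∀ w : ℂ, (D * fun w => ENNReal.ofReal (Real.exp (2 * (a * w).re - s * ‖w‖ ^ 2))) w
      = ENNReal.ofReal (Real.exp (‖a‖ ^ 2 / (1 + s))) * D (t • (w - b)) := by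
    intro w
    simp only [Pi.mul_apply, hD]
    rw [← ENNReal.ofReal_mul (by positivity), hpt, ENNReal.ofReal_mul (by positivity)]
  simp only [this]
  rw [lintegral_const_mul _ (by fun_prop), lintegral_sub_right_eq_self (fun w => D (t • w)) b,
    hscale, ← ENNReal.ofReal_mul (by positivity), Real.exp_sub, Real.exp_log hs1]
  rfl

/-! ### Mutual information from a joint density -/

/-- Mutual information of a law with log-density `ell` with respect to `ν ⊗ τ`, where `τ` is its
second marginal and `k` is the log-density of its first marginal with respect to `ν`. -/
theorem toReal_mutualInfo_withDensity {α β : Type*} [MeasurableSpace α] [MeasurableSpace β]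
    (ν : Measure α) (τ : Measure β) [IsProbabilityMeasure ν] [IsProbabilityMeasure τ]
    {ell : α × β → ℝ} (hell : Measurable ell) {k : α → ℝ} (hk : Measurable k)
    (hmarg : ∀ y, ∫⁻ g, ENNReal.ofReal (Real.exp (ell (y, g))) ∂τ
      = ENNReal.ofReal (Real.exp (k y)))
    (μ : Measure (α × β)) [IsProbabilityMeasure μ]
    (hμ : μ = (ν.prod τ).withDensity (fun x => ENNReal.ofReal (Real.exp (ell x))))
    (hsnd : μ.map Prod.snd = τ) :
    (mutualInfo μ).toReal = ∫ x, (ell x - k x.1) ∂μ := by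
  have hfst : μ.map Prod.fst = ν.withDensity (fun y => ENNReal.ofReal (Real.exp (k y))) := by
    ext s hs
    rw [Measure.map_apply measurable_fst hs, hμ, withDensity_apply _ (measurable_fst hs),
      withDensity_apply _ hs]
    have hpre : (Prod.fst ⁻¹' s : Set (α × β)) = s ×ˢ Set.univ := by ext x; simp
    rw [hpre, ← Measure.prod_restrict, lintegral_prod _ (by fun_prop)]
    simp only [Measure.restrict_univ, hmarg]
  have : IsProbabilityMeasure (μ.map Prod.fst) :=
    Measure.isProbabilityMeasure_map measurable_fst.aemeasurable
  have hprod : (μ.map Prod.fst).prod (μ.map Prod.snd)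
      = (ν.prod τ).withDensity (fun x => ENNReal.ofReal (Real.exp (k x.1))) := by
    rw [hfst, hsnd, prod_withDensity_left (by fun_prop)]
  set ρ := (μ.map Prod.fst).prod (μ.map Prod.snd) with hρ
  have hρp : IsProbabilityMeasure ρ := by rw [hρ, hsnd]; infer_instance
  have hμρ : μ = ρ.withDensity (fun x => ENNReal.ofReal (Real.exp (ell x - k x.1))) := by
    rw [hprod, ← withDensity_mul _ (by fun_prop) (by fun_prop), hμ]
    congr 1
    funext x
    rw [Pi.mul_apply, ← ENNReal.ofReal_mul (Real.exp_pos _).le, ← Real.exp_add]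
    congr 2; ring
  have hac : μ ≪ ρ := by rw [hμρ]; exact withDensity_absolutelyContinuous _ _
  unfold mutualInfo
  -- Both measures have mass one, so the divergence is the plain integral of the log-likelihood
  -- ratio, which is `ell - k`.
  rw [InformationTheory.toReal_klDiv_of_measure_eq hac (by rw [measure_univ, measure_univ])]
  refine integral_congr_ae ?_
  have hrn : μ.rnDeriv ρ =ᵐ[ρ] fun x => ENNReal.ofReal (Real.exp (ell x - k x.1)) := by
    conv_lhs => rw [hμρ]
    exact Measure.rnDeriv_withDensity ρ (by fun_prop)
  filter_upwards [hac.ae_le hrn] with x hx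
  rw [llr, hx, ENNReal.toReal_ofReal (Real.exp_pos _).le, Real.log_exp]

/-! ### The sensing rate in closed form -/

theorem sqrt_eq_of_eigendecomposition {M : ℕ} {R U : Matrix (Fin M) (Fin M) ℂ}
    (hU : U ∈ Matrix.unitaryGroup (Fin M) ℂ) {lam : Fin M → ℝ} (hlam : ∀ m, 0 ≤ lam m)
    (hRU : R = U * Matrix.diagonal (fun m => (lam m : ℂ)) * Uᴴ) :
    CFC.sqrt R = U * Matrix.diagonal (fun m => ((√(lam m) : ℝ) : ℂ)) * Uᴴ := by
  have hUU : Uᴴ * U = 1 := Matrix.mem_unitaryGroup_iff'.1 hU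
  refine CFC.sqrt_unique ?_ ?_
  · rw [hRU]
    calc _ = U * Matrix.diagonal (fun m => ((√(lam m) : ℝ) : ℂ)) * (Uᴴ * U)
          * Matrix.diagonal (fun m => ((√(lam m) : ℝ) : ℂ)) * Uᴴ := by simp only [Matrix.mul_assoc]
      _ = _ := by
        rw [hUU, Matrix.mul_one, Matrix.mul_assoc U, Matrix.diagonal_mul_diagonal]
        congr 3
        funext m
        rw [← Complex.ofReal_mul, Real.mul_self_sqrt (hlam m)]
  · rw [Matrix.nonneg_iff_posSemidef]
    refine Matrix.PosSemidef.mul_mul_conjTranspose_same ?_ U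
    rw [Matrix.posSemidef_diagonal_iff]
    intro m
    exact_mod_cast Real.sqrt_nonneg _

theorem measurable_mulVec_comp {M : ℕ} (A : Matrix (Fin M) (Fin M) ℂ) (d : Fin M → ℂ) :
    Measurable (fun w : Fin M → ℂ => A *ᵥ fun j => d j * w j) := by
  refine measurable_pi_iff.2 fun i => ?_
  simp only [Matrix.mulVec, dotProduct]
  fun_prop

/-- Since `R^(1/2) z = U diag(√λ) (Uᴴ z)` and `Uᴴ z` has the law of `z`, the last factor can be
dropped. -/
theorem vecCN_eq_map {M : ℕ} {R U : Matrix (Fin M) (Fin M) ℂ}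
    (hU : U ∈ Matrix.unitaryGroup (Fin M) ℂ) {lam : Fin M → ℝ} (hlam : ∀ m, 0 ≤ lam m)
    (hRU : R = U * Matrix.diagonal (fun m => (lam m : ℂ)) * Uᴴ) :
    vecCN R = (iidCN (Fin M)).map (fun w => U *ᵥ fun j => ((√(lam j) : ℝ) : ℂ) * w j) := by
  have hU' : Uᴴ ∈ Matrix.unitaryGroup (Fin M) ℂ := by
    rw [Matrix.mem_unitaryGroup_iff, Matrix.star_eq_conjTranspose,
      Matrix.conjTranspose_conjTranspose]
    exact Matrix.mem_unitaryGroup_iff'.1 hU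
  conv_rhs => rw [← map_iidCN_mulVec hU']
  rw [Measure.map_map (measurable_mulVec_comp _ _) (by simpa using measurable_mulVec_comp Uᴴ 1)]
  unfold vecCN
  congr 1
  funext z
  rw [sqrt_eq_of_eigendecomposition hU hlam hRU, Function.comp_apply, ← Matrix.mulVec_mulVec,
    ← Matrix.mulVec_mulVec]
  congr 1
  funext j
  rw [Matrix.mulVec_diagonal]

/-- The target response matrix as a function of i.i.d. `CN(0, 1)` entries. -/
noncomputable def targetOf (N : ℕ) {M : ℕ} (U : Matrix (Fin M) (Fin M) ℂ) (lam : Fin M → ℝ)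
    (w : Fin N → Fin M → ℂ) : Fin N → Fin M → ℂ :=
  fun n m => star ((U *ᵥ fun j => ((√(lam j) : ℝ) : ℂ) * w n j) m)

theorem measurable_targetOf (N : ℕ) {M : ℕ} (U : Matrix (Fin M) (Fin M) ℂ) (lam : Fin M → ℝ) :
    Measurable (targetOf N U lam) := by
  refine measurable_pi_iff.2 fun n => measurable_pi_iff.2 fun m => ?_
  simp only [targetOf, Matrix.mulVec, dotProduct]
  exact continuous_star.measurable.comp (by fun_prop)

theorem targetLaw_eq_map (N : ℕ) {M : ℕ} {R U : Matrix (Fin M) (Fin M) ℂ}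
    (hU : U ∈ Matrix.unitaryGroup (Fin M) ℂ) {lam : Fin M → ℝ} (hlam : ∀ m, 0 ≤ lam m)
    (hRU : R = U * Matrix.diagonal (fun m => (lam m : ℂ)) * Uᴴ) :
    targetLaw N R = (noiseLaw N M).map (targetOf N U lam) := by
  unfold targetLaw noiseLaw
  have hm := measurable_mulVec_comp U (fun j => ((√(lam j) : ℝ) : ℂ))
  have : IsProbabilityMeasure
      ((iidCN (Fin M)).map (fun w => U *ᵥ fun j => ((√(lam j) : ℝ) : ℂ) * w j)) :=
    Measure.isProbabilityMeasure_map hm.aemeasurable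
  rw [vecCN_eq_map hU hlam hRU, ← Measure.pi_map_pi (fun _ => hm.aemeasurable), Measure.map_map]
  · rfl
  · refine measurable_pi_iff.2 fun n => measurable_pi_iff.2 fun m => ?_
    exact continuous_star.measurable.comp (by fun_prop)
  · exact measurable_pi_iff.2 fun n => hm.comp (measurable_pi_apply n)

instance (N L : ℕ) : IsProbabilityMeasure (noiseLaw N L) := by
  unfold noiseLaw; infer_instance

theorem measurable_mul_right_apply {N M L : ℕ} (X : Matrix (Fin M) (Fin L) ℂ) :
    Measurable (fun (g : Fin N → Fin M → ℂ) n l => (Matrix.of g * X) n l) := by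
  refine measurable_pi_iff.2 fun n => measurable_pi_iff.2 fun l => ?_
  simp only [Matrix.mul_apply, Matrix.of_apply]
  fun_prop

/-- The noise matrix is one i.i.d. vector indexed by pairs, so `lintegral_iidCN_add` applies to it.
-/
theorem lintegral_noiseLaw_add {N L : ℕ} (x : Fin N → Fin L → ℂ)
    {F : (Fin N → Fin L → ℂ) → ℝ≥0∞} (hF : Measurable F) :
    ∫⁻ z, F (x + z) ∂(noiseLaw N L) = ∫⁻ y, ENNReal.ofReal
      (Real.exp (2 * (∑ n, ∑ l, y n l * star (x n l)).re - ∑ n, ∑ l, ‖x n l‖ ^ 2)) * F y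
        ∂(noiseLaw N L) := by
  have hc : Measurable (fun (z : Fin N × Fin L → ℂ) i j => z (i, j)) := by fun_prop
  have h := lintegral_iidCN_add (fun i : Fin N × Fin L => x i.1 i.2) (hF.comp hc)
  unfold noiseLaw
  rw [← iidCN_map_curry, lintegral_map (by fun_prop) hc, lintegral_map (by fun_prop) hc]
  simp only [Fintype.sum_prod_type] at h
  exact h

/-- Log-density of the joint law of the echo and the target response with respect to the product
of the noise law and the target law. -/
noncomputable def echoLogDensity {N M L : ℕ} (X : Matrix (Fin M) (Fin L) ℂ)
    (x : (Fin N → Fin L → ℂ) × (Fin N → Fin M → ℂ)) : ℝ :=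
  2 * (∑ n, ∑ l, x.1 n l * star ((Matrix.of x.2 * X) n l)).re
    - ∑ n, ∑ l, ‖(Matrix.of x.2 * X) n l‖ ^ 2

theorem measurable_echoLogDensity {N M L : ℕ} (X : Matrix (Fin M) (Fin L) ℂ) :
    Measurable (echoLogDensity (N := N) X) := by
  have h : ∀ (n : Fin N) (l : Fin L), Measurable
      (fun x : (Fin N → Fin L → ℂ) × (Fin N → Fin M → ℂ) => (Matrix.of x.2 * X) n l) :=
    fun n l => (measurable_pi_apply l).comp ((measurable_pi_apply n).comp
      ((measurable_mul_right_apply X).comp measurable_snd))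
  unfold echoLogDensity
  refine Measurable.sub (Measurable.const_mul (Complex.measurable_re.comp
    (Finset.measurable_fun_sum _ fun n _ => Finset.measurable_fun_sum _ fun l _ =>
      Measurable.mul (by fun_prop) (continuous_star.measurable.comp (h n l)))) 2) ?_
  exact Finset.measurable_fun_sum _ fun n _ => Finset.measurable_fun_sum _ fun l _ =>
    (h n l).norm.pow_const 2

theorem measurable_echo {N M L : ℕ} (X : Matrix (Fin M) (Fin L) ℂ) :
    Measurable (fun x : (Fin N → Fin M → ℂ) × (Fin N → Fin L → ℂ) =>
      ((fun n l => (Matrix.of x.1 * X) n l + x.2 n l : Fin N → Fin L → ℂ), x.1)) := by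
  refine Measurable.prodMk ?_ measurable_fst
  exact ((measurable_mul_right_apply X).comp measurable_fst).add measurable_snd

/-- For fixed `g` the echo is the noise translated by `g X`, so the conditional density is the
Cameron-Martin factor. -/
theorem echoLaw_eq_withDensity (N : ℕ) {M L : ℕ} (R : Matrix (Fin M) (Fin M) ℂ)
    [IsProbabilityMeasure (targetLaw N R)] (X : Matrix (Fin M) (Fin L) ℂ) :
    echoLaw N R X = ((noiseLaw N L).prod (targetLaw N R)).withDensity
      (fun x => ENNReal.ofReal (Real.exp (echoLogDensity X x))) := by
  have hd : Measurable (fun x : (Fin N → Fin L → ℂ) × (Fin N → Fin M → ℂ) =>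
      ENNReal.ofReal (Real.exp (echoLogDensity X x))) :=
    (measurable_echoLogDensity X).exp.ennreal_ofReal
  refine Measure.ext_of_lintegral _ fun F hF => ?_
  have h1 : ∫⁻ x, F x ∂(echoLaw N R X) = ∫⁻ g, ∫⁻ z,
      F ((fun n l => (Matrix.of g * X) n l) + z, g) ∂(noiseLaw N L) ∂(targetLaw N R) :=
    (lintegral_map hF (measurable_echo X)).trans
      (lintegral_prod _ (hF.comp (measurable_echo X)).aemeasurable)
  rw [h1, lintegral_withDensity_eq_lintegral_mul _ hd hF,
    lintegral_prod_symm _ (hd.mul hF).aemeasurable]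
  refine lintegral_congr fun g => ?_
  have := lintegral_noiseLaw_add (fun n l => (Matrix.of g * X) n l)
    (F := fun y => F (y, g)) (by fun_prop)
  exact this

/-! ### Decoupling of the echo into scalar streams -/

section
variable {N M L : ℕ} {R U : Matrix (Fin M) (Fin M) ℂ} {S : Matrix (Fin M) (Fin L) ℂ}

/-- The eigenbasis of the target meets the same basis in the precoder and `Uᴴ U` cancels, so each
stream carries a single independent fading coefficient. -/
theorem targetOf_mul_precoder (hU : U ∈ Matrix.unitaryGroup (Fin M) ℂ) (lam q : Fin M → ℝ)
    (S : Matrix (Fin M) (Fin L) ℂ) (w : Fin N → Fin M → ℂ) (n : Fin N) (l : Fin L) :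
    (Matrix.of (targetOf N U lam w) * (precoder U q * S)) n l
      = ∑ k, ((√(lam k) * √(q k) : ℝ) : ℂ) * star (w n k) * S k l := by
  have hUU : Uᴴ * U = 1 := Matrix.mem_unitaryGroup_iff'.1 hU
  have hT : Matrix.of (targetOf N U lam w)
      = Matrix.of (fun n j => ((√(lam j) : ℝ) : ℂ) * star (w n j)) * Uᴴ := by
    ext n m
    simp only [targetOf, Matrix.of_apply, Matrix.mulVec, dotProduct, star_sum, Matrix.mul_apply,
      Matrix.conjTranspose_apply]
    refine Finset.sum_congr rfl fun j _ => ?_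
    simp only [star_mul', RCLike.star_def, Complex.conj_ofReal]
    ring
  rw [hT, precoder, Matrix.mul_assoc, Matrix.mul_assoc U, ← Matrix.mul_assoc Uᴴ, hUU,
    Matrix.one_mul, Matrix.mul_apply]
  refine Finset.sum_congr rfl fun k _ => ?_
  rw [Matrix.diagonal_mul, Matrix.of_apply]
  push_cast
  ring

theorem sum_mul_star_of_orthogonal
    (hS : S * Sᴴ = (L : ℂ) • (1 : Matrix (Fin M) (Fin M) ℂ)) (j k : Fin M) :
    ∑ l, S j l * star (S k l) = if j = k then (L : ℂ) else 0 := by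
  have := congrFun (congrFun hS j) k
  simpa [Matrix.mul_apply, Matrix.one_apply] using this

/-- The matched filter output of stream `k` in a noise or echo row. -/
noncomputable def matched (S : Matrix (Fin M) (Fin L) ℂ) (c : Fin M → ℝ) (y : Fin L → ℂ)
    (k : Fin M) : ℂ :=
  ∑ l, ((c k : ℂ) * star (S k l)) * y l

theorem measurable_matched (S : Matrix (Fin M) (Fin L) ℂ) (c : Fin M → ℝ) (k : Fin M) :
    Measurable (fun y => matched S c y k) := by
  unfold matched; fun_prop

/-- Sufficiency of the matched filter: the likelihood sees the received row only through its
outputs. -/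
theorem sum_mul_star_signal (S : Matrix (Fin M) (Fin L) ℂ) (c : Fin M → ℝ) (y : Fin L → ℂ)
    (w : Fin M → ℂ) :
    ∑ l, y l * star (∑ k, (c k : ℂ) * star (w k) * S k l) = ∑ k, matched S c y k * w k := by
  simp only [matched, star_sum, Finset.mul_sum, Finset.sum_mul]
  rw [Finset.sum_comm]
  refine Finset.sum_congr rfl fun k _ => Finset.sum_congr rfl fun l _ => ?_
  simp only [star_mul', RCLike.star_def, Complex.conj_ofReal, Complex.conj_conj]
  ring

/-- Orthogonality of the streams removes all cross-stream interference. -/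
theorem matched_signal (hS : S * Sᴴ = (L : ℂ) • (1 : Matrix (Fin M) (Fin M) ℂ)) (c : Fin M → ℝ)
    (w : Fin M → ℂ) (k : Fin M) :
    matched S c (fun l => ∑ j, (c j : ℂ) * star (w j) * S j l) k
      = ((L * c k ^ 2 : ℝ) : ℂ) * star (w k) := by
  have : matched S c (fun l => ∑ j, (c j : ℂ) * star (w j) * S j l) k
      = ∑ j, (c k : ℂ) * (c j : ℂ) * star (w j) * ∑ l, S j l * star (S k l) := by
    simp only [matched, Finset.mul_sum]
    rw [Finset.sum_comm]
    refine Finset.sum_congr rfl fun j _ => Finset.sum_congr rfl fun l _ => ?_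
    ring
  rw [this]
  simp only [sum_mul_star_of_orthogonal hS]
  simp
  ring

theorem matched_add (S : Matrix (Fin M) (Fin L) ℂ) (c : Fin M → ℝ) (y z : Fin L → ℂ)
    (k : Fin M) : matched S c (fun l => y l + z l) k = matched S c y k + matched S c z k := by
  simp only [matched, mul_add, Finset.sum_add_distrib]

theorem sum_norm_sq_signal (hS : S * Sᴴ = (L : ℂ) • (1 : Matrix (Fin M) (Fin M) ℂ))
    (c : Fin M → ℝ) (w : Fin M → ℂ) :
    ∑ l, ‖∑ k, (c k : ℂ) * star (w k) * S k l‖ ^ 2 = ∑ k, (L * c k ^ 2) * ‖w k‖ ^ 2 := by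
  have h := sum_mul_star_signal S c (fun l => ∑ j, (c j : ℂ) * star (w j) * S j l) w
  simp only [matched_signal hS] at h
  have h2 : ((∑ l, ‖∑ k, (c k : ℂ) * star (w k) * S k l‖ ^ 2 : ℝ) : ℂ)
      = ((∑ k, (L * c k ^ 2) * ‖w k‖ ^ 2 : ℝ) : ℂ) := by
    push_cast
    simp only [← Complex.mul_conj', ← RCLike.star_def]
    rw [h]
    refine Finset.sum_congr rfl fun k _ => ?_
    push_cast
    ring
  exact_mod_cast h2

/-- Each pair of an antenna and a stream contributes a term of the shape integrated in
`lintegral_exp_stdCN`, with `a` the filter output and `s = L λ_k q_k`. -/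
theorem echoLogDensity_targetOf (hU : U ∈ Matrix.unitaryGroup (Fin M) ℂ)
    (hS : S * Sᴴ = (L : ℂ) • (1 : Matrix (Fin M) (Fin M) ℂ)) (lam q : Fin M → ℝ)
    (y : Fin N → Fin L → ℂ) (w : Fin N → Fin M → ℂ) :
    echoLogDensity (precoder U q * S) (y, targetOf N U lam w)
      = ∑ n, ∑ k, (2 * (matched S (fun k => √(lam k) * √(q k)) (y n) k * w n k).re
          - (L * (√(lam k) * √(q k)) ^ 2) * ‖w n k‖ ^ 2) := by
  unfold echoLogDensity
  simp only [targetOf_mul_precoder hU]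
  rw [Complex.re_sum, Finset.mul_sum, ← Finset.sum_sub_distrib]
  refine Finset.sum_congr rfl fun n _ => ?_
  rw [sum_mul_star_signal S (fun k => √(lam k) * √(q k)) (y n) (w n),
    sum_norm_sq_signal hS (fun k => √(lam k) * √(q k)), Complex.re_sum, Finset.mul_sum,
    ← Finset.sum_sub_distrib]

/-- Log-density of the echo law with respect to the noise law. -/
noncomputable def echoMarginal (S : Matrix (Fin M) (Fin L) ℂ) (c : Fin M → ℝ)
    (y : Fin N → Fin L → ℂ) : ℝ :=
  ∑ n, ∑ k, (‖matched S c (y n) k‖ ^ 2 / (1 + L * c k ^ 2) - Real.log (1 + L * c k ^ 2))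

theorem measurable_echoMarginal (S : Matrix (Fin M) (Fin L) ℂ) (c : Fin M → ℝ) :
    Measurable (echoMarginal (N := N) S c) := by
  unfold echoMarginal
  refine Finset.measurable_fun_sum _ fun n _ => Finset.measurable_fun_sum _ fun k _ => ?_
  exact ((((measurable_matched S c k).comp (measurable_pi_apply n)).norm.pow_const 2).div_const
    _).sub_const _

/-- The fading coefficients are independent, so the integral is a product of the scalar ones in
`lintegral_exp_stdCN`. -/
theorem lintegral_exp_echoLogDensity (hU : U ∈ Matrix.unitaryGroup (Fin M) ℂ) {lam : Fin M → ℝ}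
    (hlam : ∀ m, 0 ≤ lam m) (hRU : R = U * Matrix.diagonal (fun m => (lam m : ℂ)) * Uᴴ)
    (hS : S * Sᴴ = (L : ℂ) • (1 : Matrix (Fin M) (Fin M) ℂ)) (q : Fin M → ℝ)
    (y : Fin N → Fin L → ℂ) :
    ∫⁻ g, ENNReal.ofReal (Real.exp (echoLogDensity (precoder U q * S) (y, g))) ∂(targetLaw N R)
      = ENNReal.ofReal (Real.exp (echoMarginal S (fun k => √(lam k) * √(q k)) y)) := by
  have hm := measurable_echoLogDensity (N := N) (precoder U q * S)
  rw [targetLaw_eq_map N hU hlam hRU, lintegral_map (by fun_prop) (measurable_targetOf N U lam)]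
  simp only [echoLogDensity_targetOf hU hS, echoMarginal, Real.exp_sum]
  simp only [ENNReal.ofReal_prod_of_nonneg fun i _ => Finset.prod_nonneg fun j _ =>
    (Real.exp_pos _).le]
  unfold noiseLaw
  rw [lintegral_pi_prod (fun _ : Fin N => iidCN (Fin M)) (f := fun n w => ENNReal.ofReal
    (∏ k, Real.exp (2 * (matched S (fun k => √(lam k) * √(q k)) (y n) k * w k).re
          - (L * (√(lam k) * √(q k)) ^ 2) * ‖w k‖ ^ 2))) (fun n => by fun_prop)]
  refine Finset.prod_congr rfl fun n _ => ?_
  simp only [ENNReal.ofReal_prod_of_nonneg fun i _ => (Real.exp_pos _).le]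
  rw [lintegral_pi_prod (fun _ : Fin M => stdCN) (f := fun k w => ENNReal.ofReal
    (Real.exp (2 * (matched S (fun k => √(lam k) * √(q k)) (y n) k * w).re
          - (L * (√(lam k) * √(q k)) ^ 2) * ‖w‖ ^ 2))) (fun n => by fun_prop)]
  refine Finset.prod_congr rfl fun k _ => ?_
  exact lintegral_exp_stdCN _ (by positivity)

/-- With `s = L c_k²` and noise output `b`, the filtered echo is `s w̄ + b`. Expanding the squares
isolates `log (1 + s)` from terms whose means will cancel. -/
theorem echo_information_density (hU : U ∈ Matrix.unitaryGroup (Fin M) ℂ)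
    (hS : S * Sᴴ = (L : ℂ) • (1 : Matrix (Fin M) (Fin M) ℂ)) (lam q : Fin M → ℝ)
    (w : Fin N → Fin M → ℂ) (z : Fin N → Fin L → ℂ) {c : Fin M → ℝ}
    (hc : c = fun k => √(lam k) * √(q k)) :
    echoLogDensity (precoder U q * S)
        (fun n l => (Matrix.of (targetOf N U lam w) * (precoder U q * S)) n l + z n l,
          targetOf N U lam w)
      - echoMarginal S c
        (fun n l => (Matrix.of (targetOf N U lam w) * (precoder U q * S)) n l + z n l)
      = ∑ n, ∑ k, ((1 + L * c k ^ 2)⁻¹ * ((L * c k ^ 2) * ‖w n k‖ ^ 2 - ‖matched S c (z n) k‖ ^ 2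
          + 2 * (matched S c (z n) k * w n k).re) + Real.log (1 + L * c k ^ 2)) := by
  rw [echoLogDensity_targetOf hU hS, echoMarginal, ← Finset.sum_sub_distrib]
  refine Finset.sum_congr rfl fun n _ => ?_
  rw [← Finset.sum_sub_distrib]
  refine Finset.sum_congr rfl fun k _ => ?_
  simp only [targetOf_mul_precoder hU]
  rw [← hc, matched_add, show (fun l => ∑ k, ((√(lam k) * √(q k) : ℝ) : ℂ) * star (w n k) * S k l)
    = fun l => ∑ k, (c k : ℂ) * star (w n k) * S k l by rw [hc], matched_signal hS,
    show √(lam k) * √(q k) = c k by rw [hc]]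
  set b := matched S c (z n) k
  set s : ℝ := L * c k ^ 2 with hs
  have hs1 : (1 : ℝ) + s ≠ 0 := by positivity
  simp only [← Complex.normSq_eq_norm_sq, Complex.normSq_apply, RCLike.star_def,
      Complex.mul_re, Complex.mul_im, Complex.add_re, Complex.add_im, Complex.conj_re,
      Complex.conj_im, Complex.ofReal_re, Complex.ofReal_im]
  field_simp
  ring

end

/-! ### Mean of the information density -/

section
variable {N M L : ℕ} {R U : Matrix (Fin M) (Fin M) ℂ} {S : Matrix (Fin M) (Fin L) ℂ}

theorem memLp_noise_eval (n : Fin N) (k : Fin L) :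
    MemLp (fun w : Fin N → Fin L → ℂ => w n k) 2 (noiseLaw N L) :=
  (memLp_eval_iidCN k).comp_measurePreserving
    (measurePreserving_eval (fun _ : Fin N => iidCN (Fin L)) n)

theorem memLp_matched (S : Matrix (Fin M) (Fin L) ℂ) (c : Fin M → ℝ) (n : Fin N) (k : Fin M) :
    MemLp (fun z : Fin N → Fin L → ℂ => matched S c (z n) k) 2 (noiseLaw N L) :=
  (memLp_linear_iidCN fun l => (c k : ℂ) * star (S k l)).comp_measurePreserving
    (measurePreserving_eval (fun _ : Fin N => iidCN (Fin L)) n)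

theorem integral_norm_sq_noise_eval (n : Fin N) (k : Fin L) :
    ∫ w, ‖w n k‖ ^ 2 ∂(noiseLaw N L) = 1 := by
  unfold noiseLaw
  rw [integral_comp_eval (μ := fun _ : Fin N => iidCN (Fin L)) (f := fun z => ‖z k‖ ^ 2)
    (by fun_prop : Measurable fun z : Fin L → ℂ => ‖z k‖ ^ 2).aestronglyMeasurable, integral_norm_sq_eval_iidCN]

theorem integral_noise_eval (n : Fin N) (k : Fin L) : ∫ w, w n k ∂(noiseLaw N L) = 0 := by
  unfold noiseLaw
  rw [integral_comp_eval (μ := fun _ : Fin N => iidCN (Fin L)) (f := fun z => z k)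
    (by fun_prop : Measurable fun z : Fin L → ℂ => z k).aestronglyMeasurable, integral_eval_iidCN]

theorem integral_norm_sq_matched
    (hS : S * Sᴴ = (L : ℂ) • (1 : Matrix (Fin M) (Fin M) ℂ)) (c : Fin M → ℝ) (n : Fin N)
    (k : Fin M) :
    ∫ z, ‖matched S c (z n) k‖ ^ 2 ∂(noiseLaw N L) = L * c k ^ 2 := by
  unfold noiseLaw
  rw [integral_comp_eval (μ := fun _ : Fin N => iidCN (Fin L))
    (f := fun z => ‖matched S c z k‖ ^ 2)
    ((measurable_matched S c k).norm.pow_const 2).aestronglyMeasurable]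
  unfold matched
  rw [integral_norm_sq_linear_iidCN]
  have h := sum_mul_star_of_orthogonal hS k k
  rw [if_pos rfl] at h
  have h2 : ((∑ l, ‖S k l‖ ^ 2 : ℝ) : ℂ) = ((L : ℝ) : ℂ) := by
    push_cast
    simp only [← Complex.mul_conj', ← RCLike.star_def]
    exact h
  have h3 : ∑ l, ‖S k l‖ ^ 2 = (L : ℝ) := by exact_mod_cast h2
  simp only [norm_mul, mul_pow, norm_star, Complex.norm_real, Real.norm_eq_abs, sq_abs]
  rw [← Finset.mul_sum, h3, mul_comm]

/-- The signal and noise energies both have mean `L c_k²` and cancel; the cross term has mean zero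
because target and noise are independent and the target coefficients are centred. -/
theorem integral_information_density
    (hS : S * Sᴴ = (L : ℂ) • (1 : Matrix (Fin M) (Fin M) ℂ)) (c : Fin M → ℝ) :
    ∫ x : (Fin N → Fin M → ℂ) × (Fin N → Fin L → ℂ),
      ∑ n, ∑ k, ((1 + L * c k ^ 2)⁻¹ * ((L * c k ^ 2) * ‖x.1 n k‖ ^ 2 - ‖matched S c (x.2 n) k‖ ^ 2
          + 2 * (matched S c (x.2 n) k * x.1 n k).re) + Real.log (1 + L * c k ^ 2))
      ∂((noiseLaw N M).prod (noiseLaw N L))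
      = N * ∑ k, Real.log (1 + L * c k ^ 2) := by
  have i1 : ∀ n k, Integrable (fun x : (Fin N → Fin M → ℂ) × (Fin N → Fin L → ℂ) =>
      (L * c k ^ 2) * ‖x.1 n k‖ ^ 2) ((noiseLaw N M).prod (noiseLaw N L)) := fun n k =>
    (((memLp_noise_eval n k).norm.integrable_sq).comp_fst _).const_mul _
  have i2 : ∀ n k, Integrable (fun x : (Fin N → Fin M → ℂ) × (Fin N → Fin L → ℂ) =>
      ‖matched S c (x.2 n) k‖ ^ 2) ((noiseLaw N M).prod (noiseLaw N L)) := fun n k =>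
    ((memLp_matched S c n k).norm.integrable_sq).comp_snd _
  have i3' : ∀ n k, Integrable (fun x : (Fin N → Fin M → ℂ) × (Fin N → Fin L → ℂ) =>
      x.1 n k * matched S c (x.2 n) k) ((noiseLaw N M).prod (noiseLaw N L)) := fun n k =>
    ((memLp_noise_eval n k).integrable one_le_two).mul_prod
      ((memLp_matched S c n k).integrable one_le_two)
  have i3 : ∀ n k, Integrable (fun x : (Fin N → Fin M → ℂ) × (Fin N → Fin L → ℂ) =>
      2 * (matched S c (x.2 n) k * x.1 n k).re) ((noiseLaw N M).prod (noiseLaw N L)) := by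
    intro n k
    have := (i3' n k).re.const_mul 2
    simp only [mul_comm (matched S c _ k)]
    exact this
  have i4 : ∀ n k, Integrable (fun x : (Fin N → Fin M → ℂ) × (Fin N → Fin L → ℂ) =>
      ((1 + L * c k ^ 2)⁻¹ * ((L * c k ^ 2) * ‖x.1 n k‖ ^ 2 - ‖matched S c (x.2 n) k‖ ^ 2
          + 2 * (matched S c (x.2 n) k * x.1 n k).re)))
      ((noiseLaw N M).prod (noiseLaw N L)) := fun n k =>
    (((i1 n k).sub (i2 n k)).add (i3 n k)).const_mul _
  have i5 : ∀ n k, Integrable (fun x : (Fin N → Fin M → ℂ) × (Fin N → Fin L → ℂ) =>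
      ((1 + L * c k ^ 2)⁻¹ * ((L * c k ^ 2) * ‖x.1 n k‖ ^ 2 - ‖matched S c (x.2 n) k‖ ^ 2
          + 2 * (matched S c (x.2 n) k * x.1 n k).re) + Real.log (1 + L * c k ^ 2)))
      ((noiseLaw N M).prod (noiseLaw N L)) := fun n k => (i4 n k).add (integrable_const _)
  have v1 : ∀ n k, ∫ x : (Fin N → Fin M → ℂ) × (Fin N → Fin L → ℂ),
      (L * c k ^ 2) * ‖x.1 n k‖ ^ 2 ∂((noiseLaw N M).prod (noiseLaw N L)) = L * c k ^ 2 := by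
    intro n k
    rw [integral_const_mul, integral_fun_fst (fun w : Fin N → Fin M → ℂ => ‖w n k‖ ^ 2),
      integral_norm_sq_noise_eval]
    simp
  have v2 : ∀ n k, ∫ x : (Fin N → Fin M → ℂ) × (Fin N → Fin L → ℂ),
      ‖matched S c (x.2 n) k‖ ^ 2 ∂((noiseLaw N M).prod (noiseLaw N L)) = L * c k ^ 2 := by
    intro n k
    rw [integral_fun_snd (fun z : Fin N → Fin L → ℂ => ‖matched S c (z n) k‖ ^ 2),
      integral_norm_sq_matched hS]
    simp
  have v3 : ∀ n k, ∫ x : (Fin N → Fin M → ℂ) × (Fin N → Fin L → ℂ),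
      2 * (matched S c (x.2 n) k * x.1 n k).re ∂((noiseLaw N M).prod (noiseLaw N L)) = 0 := by
    intro n k
    have h := integral_prod_mul (μ := noiseLaw N M) (ν := noiseLaw N L)
      (fun w : Fin N → Fin M → ℂ => w n k) (fun z => matched S c (z n) k)
    rw [integral_noise_eval, zero_mul] at h
    have h2 := integral_re (i3' n k)
    rw [h] at h2
    simp only [mul_comm (matched S c _ k)]
    rw [integral_const_mul]
    simpa using h2
  rw [integral_finsetSum _ fun n _ => integrable_finsetSum _ fun k _ => i5 n k]
  have : ∀ n : Fin N, ∫ x : (Fin N → Fin M → ℂ) × (Fin N → Fin L → ℂ),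
      ∑ k, ((1 + L * c k ^ 2)⁻¹ * ((L * c k ^ 2) * ‖x.1 n k‖ ^ 2 - ‖matched S c (x.2 n) k‖ ^ 2
          + 2 * (matched S c (x.2 n) k * x.1 n k).re) + Real.log (1 + L * c k ^ 2))
      ∂((noiseLaw N M).prod (noiseLaw N L)) = ∑ k, Real.log (1 + L * c k ^ 2) := by
    intro n
    rw [integral_finsetSum _ fun k _ => i5 n k]
    refine Finset.sum_congr rfl fun k _ => ?_
    rw [integral_add (i4 n k) (integrable_const _), integral_const_mul,
      integral_add (f := fun x : (Fin N → Fin M → ℂ) × (Fin N → Fin L → ℂ) =>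
        (L * c k ^ 2) * ‖x.1 n k‖ ^ 2 - ‖matched S c (x.2 n) k‖ ^ 2)
        ((i1 n k).sub (i2 n k)) (i3 n k), integral_sub (i1 n k) (i2 n k), v1, v2, v3]
    simp
  simp only [this]
  simp

/-- The sensing rate is that of parallel Gaussian channels with gains `L λ_m`. -/
theorem SR_eq (hU : U ∈ Matrix.unitaryGroup (Fin M) ℂ) {lam : Fin M → ℝ}
    (hlam : ∀ m, 0 ≤ lam m) (hRU : R = U * Matrix.diagonal (fun m => (lam m : ℂ)) * Uᴴ)
    (hS : S * Sᴴ = (L : ℂ) • (1 : Matrix (Fin M) (Fin M) ℂ)) {q : Fin M → ℝ}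
    (hq : ∀ m, 0 ≤ q m) :
    SR N R U S q = N / L * ∑ m, Real.logb 2 (1 + (L * lam m) * q m) := by
  have hT := targetLaw_eq_map N hU hlam hRU
  have hTm := measurable_targetOf N U lam
  have hTp : IsProbabilityMeasure (targetLaw N R) := by
    rw [hT]; exact Measure.isProbabilityMeasure_map hTm.aemeasurable
  have hem := measurable_echo (N := N) (precoder U q * S)
  have hEp : IsProbabilityMeasure (echoLaw N R (precoder U q * S)) :=
    Measure.isProbabilityMeasure_map hem.aemeasurable
  have hsnd : (echoLaw N R (precoder U q * S)).map Prod.snd = targetLaw N R := by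
    unfold echoLaw
    rw [Measure.map_map measurable_snd hem]
    exact Measure.fst_prod
  have hmi := toReal_mutualInfo_withDensity (noiseLaw N L) (targetLaw N R)
    (measurable_echoLogDensity (precoder U q * S))
    (measurable_echoMarginal S (fun k => √(lam k) * √(q k)))
    (lintegral_exp_echoLogDensity hU hlam hRU hS q) _ (echoLaw_eq_withDensity N R _) hsnd
  set c : Fin M → ℝ := fun k => √(lam k) * √(q k) with hc
  have hprod : (targetLaw N R).prod (noiseLaw N L)
      = ((noiseLaw N M).prod (noiseLaw N L)).map (Prod.map (targetOf N U lam) id) := by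
    rw [hT]
    conv_lhs => rw [← Measure.map_id (μ := noiseLaw N L)]
    exact Measure.map_prod_map _ _ hTm measurable_id
  have hfm : Measurable (fun x : (Fin N → Fin L → ℂ) × (Fin N → Fin M → ℂ) =>
      echoLogDensity (precoder U q * S) x - echoMarginal S c x.1) :=
    (measurable_echoLogDensity _).sub ((measurable_echoMarginal S c).comp measurable_fst)
  have hI : (mutualInfo (echoLaw N R (precoder U q * S))).toReal
      = N * ∑ k, Real.log (1 + L * c k ^ 2) := by
    have hcomp := hem.comp (hTm.prodMap (measurable_id (α := Fin N → Fin L → ℂ)))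
    have hecho := Measure.map_map (μ := (noiseLaw N M).prod (noiseLaw N L)) hem
      (hTm.prodMap (measurable_id (α := Fin N → Fin L → ℂ)))
    rw [← hprod] at hecho
    change echoLaw N R (precoder U q * S) = _ at hecho
    rw [hmi, hecho, integral_map hcomp.aemeasurable hfm.aestronglyMeasurable,
      ← integral_information_density hS c]
    refine integral_congr_ae (ae_of_all _ fun x => ?_)
    exact echo_information_density hU hS lam q x.1 x.2 hc
  have hc2 : ∀ k, L * c k ^ 2 = (L * lam k) * q k := by
    intro k
    rw [hc, mul_pow, Real.sq_sqrt (hlam k), Real.sq_sqrt (hq k), mul_assoc]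
  unfold SR sensingRate
  rw [hI]
  simp only [hc2, Real.logb, ← Finset.sum_div]
  ring

end

/-! ### The zero-forcing gain -/

/-- The effective channel power gain `|v_mᴴ a_m|²` of user `m` after zero forcing. -/
noncomputable def zfGain {K M : ℕ} (A : Matrix (Fin K) (Fin M) ℂ) (m : Fin M) : ℝ :=
  ‖star (equalizer A m) ⬝ᵥ (fun k => A k m)‖ ^ 2

theorem CR_eq {K M : ℕ} (h : Fin M → Matrix (Fin K) (Fin M) ℂ) (U : Matrix (Fin M) (Fin M) ℂ)
    (q : Fin M → ℝ) :
    CR h U q = ∑ m, Real.logb 2 (1 + zfGain (h m * U) m * q m) := by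
  unfold CR userSNR zfGain
  refine Finset.sum_congr rfl fun m _ => ?_
  rw [mul_comm (q m)]
  rfl

/-- Inversion is discontinuous at singular matrices but measurable, being the inverted determinant
times the adjugate. The argument `C` lists the columns, hence the transpose. -/
theorem measurable_zfGain {K M : ℕ} (m : Fin M) :
    Measurable (fun C : Fin M → Fin K → ℂ => zfGain (Matrix.of C)ᵀ m) := by
  have hA : Continuous (fun C : Fin M → Fin K → ℂ => (Matrix.of C)ᵀ) :=
    Continuous.matrix_transpose continuous_id
  have hB : Continuous (fun C : Fin M → Fin K → ℂ => ((Matrix.of C)ᵀ)ᴴ * (Matrix.of C)ᵀ) :=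
    hA.matrix_conjTranspose.matrix_mul hA
  have hinv : ∀ i j, Measurable (fun C : Fin M → Fin K → ℂ =>
      (((Matrix.of C)ᵀ)ᴴ * (Matrix.of C)ᵀ)⁻¹ i j) := by
    intro i j
    simp only [Matrix.inv_def, Ring.inverse_eq_inv, Matrix.smul_apply, smul_eq_mul]
    exact hB.matrix_det.measurable.inv.mul (hB.matrix_adjugate.matrix_elem i j).measurable
  have hx : ∀ k, Measurable (fun C : Fin M → Fin K → ℂ =>
      ((Matrix.of C)ᵀ * (((Matrix.of C)ᵀ)ᴴ * (Matrix.of C)ᵀ)⁻¹) k m) := by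
    intro k
    simp only [Matrix.mul_apply (M := (Matrix.of _)ᵀ)]
    exact Finset.measurable_fun_sum _ fun j _ =>
      (hA.matrix_elem k j).measurable.mul (hinv j m)
  have hn : Measurable (fun C : Fin M → Fin K → ℂ => ‖WithLp.toLp 2 (fun i =>
      ((Matrix.of C)ᵀ * (((Matrix.of C)ᵀ)ᴴ * (Matrix.of C)ᵀ)⁻¹) i m)‖) := by
    simp only [EuclideanSpace.norm_eq]
    exact (Finset.measurable_fun_sum _ fun i _ => (hx i).norm.pow_const 2).sqrt
  unfold zfGain equalizer
  simp only [dotProduct, Pi.star_apply]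
  refine (Measurable.norm (Finset.measurable_fun_sum _ fun k _ => ?_)).pow_const 2
  exact (continuous_star.measurable.comp ((hx k).div (Complex.measurable_ofReal.comp hn))).mul
    (hA.matrix_elem k m).measurable

/-- The zero-forcing gain is the squared distance of a column from the span of the others. -/
theorem zfGain_eq_norm_proj {K M : ℕ} (A : Matrix (Fin K) (Fin M) ℂ)
    (hA : LinearIndependent ℂ A.col) (m : Fin M)
    (W : Submodule ℂ (EuclideanSpace ℂ (Fin K)))
    (hW : W = Submodule.span ℂ ((fun j => WithLp.toLp 2 (A.col j)) '' {j | j ≠ m})) :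
    zfGain A m = ‖Wᗮ.starProjection (WithLp.toLp 2 (A.col m))‖ ^ 2 := by
  have hinj : Function.Injective A.mulVec := Matrix.mulVec_injective_iff.2 hA
  have hdet : IsUnit (Aᴴ * A).det :=
    (Matrix.isUnit_iff_isUnit_det _).1 (Matrix.PosDef.conjTranspose_mul_self A hinj).isUnit
  set B := (Aᴴ * A)⁻¹ with hB
  set x : Fin K → ℂ := fun k => (A * B) k m with hx
  have hBB : Aᴴ * A * B = 1 := Matrix.mul_nonsing_inv _ hdet
  -- The vector `x` is dual to the columns: orthogonal to all but the `m`-th, with which it pairs to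
  -- one. So the gain is `‖x‖⁻²`, and the projection of `a_m` will be `x / ‖x‖²`.
  have hxA : ∀ j, ∑ k, star (A k j) * x k = if j = m then 1 else 0 := by
    intro j
    have h1 : (Aᴴ * (A * B)) j m = (1 : Matrix (Fin M) (Fin M) ℂ) j m := by
      rw [← Matrix.mul_assoc, hBB]
    rw [Matrix.mul_apply, Matrix.one_apply] at h1
    simpa only [Matrix.conjTranspose_apply] using h1
  set xE : EuclideanSpace ℂ (Fin K) := WithLp.toLp 2 x with hxE
  set aE : Fin M → EuclideanSpace ℂ (Fin K) := fun j => WithLp.toLp 2 (A.col j) with haE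
  have hinner : ∀ j, inner ℂ (aE j) xE = if j = m then (1 : ℂ) else 0 := by
    intro j
    rw [← hxA j, PiLp.inner_apply]
    refine Finset.sum_congr rfl fun k _ => ?_
    simp only [haE, hxE, RCLike.inner_apply, Matrix.col_apply, RCLike.star_def]
    ring
  have hxsum : xE = ∑ j, B j m • aE j := by
    ext k
    simp only [hxE, hx, Matrix.mul_apply, WithLp.ofLp_sum, WithLp.ofLp_smul, Finset.sum_apply,
      Pi.smul_apply, haE, Matrix.col_apply, smul_eq_mul]
    exact Finset.sum_congr rfl fun j _ => mul_comm _ _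
  have hxx : inner ℂ xE xE = star (B m m) := by
    conv_lhs => enter [2]; rw [hxsum]
    rw [sum_inner]
    simp only [inner_smul_left, hinner]
    simp
  have hnsq : ((‖xE‖ ^ 2 : ℝ) : ℂ) = star (B m m) := by
    rw [← hxx, inner_self_eq_norm_sq_to_K]; push_cast; rfl
  have hBreal : B m m = ((‖xE‖ ^ 2 : ℝ) : ℂ) := by
    rw [← star_star (B m m), ← hnsq, RCLike.star_def, Complex.conj_ofReal]
  have hxne : xE ≠ 0 := by
    intro h0
    have := hinner m
    rw [h0, inner_zero_right, if_pos rfl] at this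
    exact zero_ne_one this
  have hn0 : ‖xE‖ ≠ 0 := norm_ne_zero_iff.2 hxne
  have hgain : zfGain A m = (‖xE‖ ^ 2)⁻¹ := by
    have h1 : star (equalizer A m) ⬝ᵥ (fun k => A k m) = ((‖xE‖ : ℝ) : ℂ)⁻¹ := by
      have h2 := congrArg star (hxA m)
      rw [if_pos rfl, star_one, star_sum] at h2
      unfold equalizer
      simp only [dotProduct, Pi.star_apply]
      rw [← one_mul ((‖xE‖ : ℝ) : ℂ)⁻¹, ← h2, Finset.sum_mul]
      refine Finset.sum_congr rfl fun k _ => ?_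
      simp only [star_mul', star_div₀, RCLike.star_def, Complex.conj_ofReal,
        Complex.conj_conj]
      rw [div_eq_mul_inv]
      change (starRingEnd ℂ) (x k) * ((‖xE‖ : ℝ) : ℂ)⁻¹ * A k m = _
      ring
    unfold zfGain
    rw [h1, norm_inv, Complex.norm_real, norm_norm, inv_pow]
  have hxW : xE ∈ Wᗮ := by
    rw [Submodule.mem_orthogonal, hW]
    intro u hu
    induction hu using Submodule.span_induction with
    | mem u hu =>
      obtain ⟨j, hj, rfl⟩ := hu
      have := hinner j
      rwa [if_neg hj] at this
    | zero => exact inner_zero_left _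
    | add u v _ _ h1 h2 => rw [inner_add_left, h1, h2, add_zero]
    | smul c u _ h1 => rw [inner_smul_left, h1, mul_zero]
  have hproj : Wᗮ.starProjection (aE m) = (B m m)⁻¹ • xE := by
    refine Submodule.eq_starProjection_of_mem_orthogonal' (z := aE m - (B m m)⁻¹ • xE)
      (Submodule.smul_mem _ _ hxW) ?_ (add_sub_cancel _ _).symm
    have hBm : B m m ≠ 0 := by
      rw [hBreal]; exact_mod_cast pow_ne_zero 2 hn0
    -- In the expansion of `x` over the columns, dividing by the coefficient of `a_m` leaves a
    -- remainder in the span of the others.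
    have : aE m - (B m m)⁻¹ • xE
        = - ∑ j ∈ Finset.univ.erase m, ((B m m)⁻¹ * B j m) • aE j := by
      rw [hxsum, ← Finset.add_sum_erase _ _ (Finset.mem_univ m), smul_add, smul_smul,
        inv_mul_cancel₀ hBm, one_smul, Finset.smul_sum]
      simp only [smul_smul]
      abel
    rw [this]
    refine Submodule.le_orthogonal_orthogonal W (neg_mem (Submodule.sum_mem _ fun j hj => ?_))
    rw [hW]
    exact Submodule.smul_mem _ _ (Submodule.subset_span ⟨j, Finset.ne_of_mem_erase hj, rfl⟩)
  change zfGain A m = ‖Wᗮ.starProjection (aE m)‖ ^ 2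
  rw [hgain, hproj, norm_smul, norm_inv, hBreal, Complex.norm_real, norm_pow, norm_norm]
  field_simp

/-! ### Gamma laws -/

theorem gammaMeasure_apply {a : ℝ} (ha : 0 < a) {s : Set ℝ} (hs : MeasurableSet s) :
    gammaMeasure a 1 s = ENNReal.ofReal ((Real.Gamma a)⁻¹ *
      ∫ t in Set.Ioi (0 : ℝ), t ^ (a - 1) * s.indicator (fun t => Real.exp (-t)) t) := by
  have hint : Integrable (gammaPDFReal a 1) := by
    refine ⟨(measurable_gammaPDFReal a 1).aestronglyMeasurable, ?_⟩
    rw [hasFiniteIntegral_iff_ofReal (ae_of_all _ (gammaPDFReal_nonneg ha one_pos))]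
    exact (lintegral_gammaPDF_eq_one ha one_pos).trans_lt ENNReal.one_lt_top
  have h0 : ∀ x, x ∉ Set.Ici (0 : ℝ) → s.indicator (gammaPDFReal a 1) x = 0 := by
    intro x hx
    refine Set.indicator_apply_eq_zero.2 fun _ => ?_
    exact if_neg hx
  rw [show gammaMeasure a 1 = volume.withDensity (fun x => ENNReal.ofReal (gammaPDFReal a 1 x))
      from rfl, withDensity_ofReal_apply hint (gammaPDFReal_nonneg ha one_pos) hs,
    ← setIntegral_eq_integral_of_forall_compl_eq_zero h0, integral_Ici_eq_integral_Ioi,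
    ← integral_const_mul]
  congr 1
  refine setIntegral_congr_fun measurableSet_Ioi fun t ht => ?_
  by_cases hts : t ∈ s
  · rw [Set.indicator_of_mem hts, Set.indicator_of_mem hts, gammaPDFReal,
      if_pos (le_of_lt ht)]
    simp
    ring
  · rw [Set.indicator_of_notMem hts, Set.indicator_of_notMem hts]
    ring

/-- Polar coordinates in real dimension `2 d` give the radial density `r^(2d-1) exp(-r²)`, and `t =
r²` turns it into `t^(d-1) exp(-t)`. The constant can stay unspecified because normalization
determines it. -/
theorem iidCN_sum_sq_apply {d : ℕ} (hd : 0 < d) : ∃ κ : ℝ, ∀ s : Set ℝ, MeasurableSet s →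
    ((iidCN (Fin d)).map (fun z => ∑ i, ‖z i‖ ^ 2)) s = ENNReal.ofReal (κ *
      ∫ t in Set.Ioi (0 : ℝ), t ^ ((d : ℝ) - 1) * s.indicator (fun t => Real.exp (-t)) t) := by
  have : NeZero d := ⟨hd.ne'⟩
  let e : (Fin d → ℂ) ≃L[ℝ] EuclideanSpace ℂ (Fin d) :=
    (PiLp.continuousLinearEquiv 2 ℝ (fun _ : Fin d => ℂ)).symm
  have he : ∀ z, ‖e z‖ ^ 2 = ∑ i, ‖z i‖ ^ 2 := fun z => EuclideanSpace.norm_sq_eq _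
  set μ' : Measure (EuclideanSpace ℂ (Fin d)) := (volume : Measure (Fin d → ℂ)).map e with hμ'
  have : μ'.IsAddHaarMeasure := e.isAddHaarMeasure_map volume
  have hfin : Module.finrank ℝ (EuclideanSpace ℂ (Fin d)) = 2 * d := by
    rw [finrank_real_of_complex, finrank_euclideanSpace, Fintype.card_fin]
  have hg : Integrable (fun z : Fin d → ℂ =>
      (Real.pi⁻¹) ^ Fintype.card (Fin d) * Real.exp (-∑ i, ‖z i‖ ^ 2)) := by
    refine ⟨Measurable.aestronglyMeasurable (by fun_prop), ?_⟩
    rw [hasFiniteIntegral_iff_ofReal (ae_of_all _ fun z => by positivity)]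
    have h : iidCN (Fin d) Set.univ = 1 := measure_univ
    rw [iidCN_eq_withDensity, withDensity_apply _ MeasurableSet.univ, setLIntegral_univ] at h
    rw [h]; exact ENNReal.one_lt_top
  refine ⟨(2 * d : ℕ) * μ'.real (Metric.ball 0 1) * (Real.pi⁻¹) ^ Fintype.card (Fin d) / 2,
    fun s hs => ?_⟩
  have hNm : Measurable (fun z : Fin d → ℂ => ∑ i, ‖z i‖ ^ 2) := by fun_prop
  set h : ℝ → ℝ := fun y => s.indicator (fun t => Real.exp (-t)) (y ^ 2) with hh
  have hind : ∀ z : Fin d → ℂ, ((fun z : Fin d → ℂ => ∑ i, ‖z i‖ ^ 2) ⁻¹' s).indicator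
      (fun z => (Real.pi⁻¹) ^ Fintype.card (Fin d) * Real.exp (-∑ i, ‖z i‖ ^ 2)) z
      = (Real.pi⁻¹) ^ Fintype.card (Fin d) * h ‖e z‖ := by
    intro z
    simp only [hh, he]
    by_cases hz : ∑ i, ‖z i‖ ^ 2 ∈ s
    · rw [Set.indicator_of_mem hz, Set.indicator_of_mem (by exact hz)]
    · rw [Set.indicator_of_notMem hz, Set.indicator_of_notMem (by exact hz), mul_zero]
  have hpolar : ∫ z : Fin d → ℂ, h ‖e z‖ = ∫ x, h ‖x‖ ∂μ' :=
    (integral_map_equiv e.toHomeomorph.toMeasurableEquiv (fun x => h ‖x‖)).symm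
  have hsub := integral_comp_rpow_Ioi
    (fun t => t ^ ((d : ℝ) - 1) * s.indicator (fun t => Real.exp (-t)) t) (two_ne_zero (α := ℝ))
  have hpow : ∫ x in Set.Ioi (0 : ℝ), (|(2 : ℝ)| * x ^ ((2 : ℝ) - 1)) •
      ((x ^ (2 : ℝ)) ^ ((d : ℝ) - 1) * s.indicator (fun t => Real.exp (-t)) (x ^ (2 : ℝ)))
      = 2 * ∫ y in Set.Ioi (0 : ℝ), y ^ (2 * d - 1) • h y := by
    rw [← integral_const_mul]
    refine setIntegral_congr_fun measurableSet_Ioi fun y hy => ?_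
    have hy0 : (0 : ℝ) < y := hy
    simp only [hh, smul_eq_mul, abs_two, Real.rpow_two]
    have hexp : y ^ ((2 : ℝ) - 1) * (y ^ 2) ^ ((d : ℝ) - 1) = y ^ (2 * d - 1) := by
      rw [← Real.rpow_natCast y (2 * d - 1), ← Real.rpow_natCast y 2, ← Real.rpow_mul hy0.le,
        ← Real.rpow_add hy0]
      congr 1
      rw [Nat.cast_sub (by omega)]
      push_cast
      ring
    rw [← hexp]
    ring
  rw [Measure.map_apply hNm hs, iidCN_eq_withDensity,
    withDensity_ofReal_apply hg (fun z => by positivity) (hNm hs)]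
  simp only [hind]
  rw [integral_const_mul, hpolar, integral_fun_norm_addHaar μ' h, hfin, ← hsub, hpow]
  congr 1
  simp only [nsmul_eq_mul, smul_eq_mul]
  ring

/-- The squared norm of a vector of `d` independent `CN(0, 1)` entries is `Gamma(d, 1)`. -/
theorem map_sum_sq_iidCN {d : ℕ} (hd : 0 < d) :
    (iidCN (Fin d)).map (fun z => ∑ i, ‖z i‖ ^ 2) = gammaMeasure d 1 := by
  have hdR : (0 : ℝ) < d := by exact_mod_cast hd
  obtain ⟨κ, hκ⟩ := iidCN_sum_sq_apply hd
  have hNm : Measurable (fun z : Fin d → ℂ => ∑ i, ‖z i‖ ^ 2) := by fun_prop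
  have h1 := hκ Set.univ MeasurableSet.univ
  have h2 := gammaMeasure_apply hdR MeasurableSet.univ
  have := isProbabilityMeasure_gammaMeasure hdR one_pos
  have := Measure.isProbabilityMeasure_map (μ := iidCN (Fin d)) hNm.aemeasurable
  rw [measure_univ, eq_comm, ENNReal.ofReal_eq_one] at h1 h2
  -- Equal total masses identify the constant, so the volume of the unit ball is never computed.
  have hκ2 : κ = (Real.Gamma d)⁻¹ := by
    refine mul_right_cancel₀ ?_ (h1.trans h2.symm)
    intro h0
    rw [h0, mul_zero] at h1
    exact zero_ne_one h1
  ext s hs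
  rw [hκ s hs, gammaMeasure_apply hdR hs, hκ2]

theorem gamma_log_integrand {a : ℝ} {t : ℝ} (ht : t ∈ Set.Ioi (0 : ℝ)) :
    (t : ℂ) ^ ((a : ℂ) - 1) * (Real.log t * Real.exp (-t))
      = ((t ^ (a - 1) * (Real.log t * Real.exp (-t)) : ℝ) : ℂ) := by
  have : (a : ℂ) - 1 = ((a - 1 : ℝ) : ℂ) := by push_cast; rfl
  rw [this, ← Complex.ofReal_cpow (le_of_lt ht)]
  push_cast
  rfl

theorem integrableOn_gamma_log {a : ℝ} (ha : 0 < a) :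
    IntegrableOn (fun t : ℝ => t ^ (a - 1) * (Real.log t * Real.exp (-t))) (Set.Ioi 0) := by
  have hm : MellinConvergent (fun t => Real.log t • ((Real.exp (-t) : ℝ) : ℂ)) (a : ℂ) := by
    -- Exponential decay beats any power, so any exponent above `a` serves at infinity; `b = 0`
    -- records boundedness near zero.
    refine (mellin_hasDerivAt_of_isBigO_rpow (E := ℂ) (a := a + 1) (b := 0) ?_ ?_ ?_ ?_ ?_).1
    · refine (Continuous.continuousOn ?_).locallyIntegrableOn measurableSet_Ioi
      fun_prop
    · rw [← Asymptotics.isBigO_norm_left]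
      simp_rw [Complex.norm_real, Asymptotics.isBigO_norm_left]
      simpa only [neg_one_mul] using (isLittleO_exp_neg_mul_rpow_atTop zero_lt_one _).isBigO
    · simp
    · simp_rw [neg_zero, Real.rpow_zero]
      refine Asymptotics.isBigO_const_of_tendsto (?_ : Tendsto _ _ (𝓝 (1 : ℂ))) one_ne_zero
      rw [(by simp : (1 : ℂ) = Real.exp (-0))]
      exact (Complex.continuous_ofReal.comp
        (Real.continuous_exp.comp continuous_neg)).continuousWithinAt
    · simpa using ha
  have h2 : IntegrableOn (fun t : ℝ => ((t ^ (a - 1) * (Real.log t * Real.exp (-t)) : ℝ) : ℂ))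
      (Set.Ioi 0) := by
    refine IntegrableOn.congr_fun hm (fun t ht => ?_) measurableSet_Ioi
    simp only [← gamma_log_integrand ht, smul_eq_mul, Complex.real_smul]
  exact h2.re

/-- The Gamma integral is differentiated under the integral sign in the complex variable, then
restricted to the real axis. -/
theorem digamma_eq {a : ℝ} (ha : 0 < a) :
    digamma a = (Real.Gamma a)⁻¹ *
      ∫ t in Set.Ioi (0 : ℝ), t ^ (a - 1) * (Real.log t * Real.exp (-t)) := by
  have h := Complex.hasDerivAt_GammaIntegral (s := (a : ℂ)) (by simpa using ha)
  rw [setIntegral_congr_fun measurableSet_Ioi (fun t ht => gamma_log_integrand (a := a) ht),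
    integral_complex_ofReal] at h
  have h2 : HasDerivAt Complex.Gamma ((∫ t in Set.Ioi (0 : ℝ),
      t ^ (a - 1) * (Real.log t * Real.exp (-t)) : ℝ) : ℂ) (a : ℂ) := by
    refine h.congr_of_eventuallyEq ?_
    have : {s : ℂ | 0 < s.re} ∈ 𝓝 (a : ℂ) :=
      (isOpen_lt continuous_const Complex.continuous_re).mem_nhds (by simpa using ha)
    filter_upwards [this] with s hs
    exact Complex.Gamma_eq_integral hs
  have h3 : HasDerivAt Real.Gamma (∫ t in Set.Ioi (0 : ℝ),
      t ^ (a - 1) * (Real.log t * Real.exp (-t))) a := by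
    have := h2.real_of_complex
    rwa [Complex.ofReal_re] at this
  unfold digamma
  rw [(h3.log (Real.Gamma_pos_of_pos ha).ne').deriv, div_eq_inv_mul]

theorem gammaPDF_toReal_mul_log {a : ℝ} (ha : 0 < a) (t : ℝ) :
    (gammaPDF a 1 t).toReal • Real.log t = (Set.Ioi (0 : ℝ)).indicator
      (fun t => (Real.Gamma a)⁻¹ * (t ^ (a - 1) * (Real.log t * Real.exp (-t)))) t := by
  rw [gammaPDF, ENNReal.toReal_ofReal (gammaPDFReal_nonneg ha one_pos t), gammaPDFReal]
  rcases lt_trichotomy t 0 with h | h | h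
  · rw [if_neg (not_le.2 h), Set.indicator_of_notMem (by simpa using h.le), zero_smul]
  · simp [h]
  · rw [if_pos h.le, Set.indicator_of_mem (by exact h)]
    simp
    ring

theorem measurable_gammaPDF_one (a : ℝ) : Measurable (gammaPDF a 1) :=
  (measurable_gammaPDFReal a 1).ennreal_ofReal

theorem integrable_log_gammaMeasure {a : ℝ} (ha : 0 < a) :
    Integrable Real.log (gammaMeasure a 1) := by
  unfold gammaMeasure
  rw [integrable_withDensity_iff_integrable_smul' (measurable_gammaPDF_one a)
    (ae_of_all _ fun _ => ENNReal.ofReal_lt_top)]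
  simp only [gammaPDF_toReal_mul_log ha]
  rw [integrable_indicator_iff measurableSet_Ioi]
  exact (integrableOn_gamma_log ha).const_mul _

/-- The mean of the logarithm of a `Gamma(a, 1)` variable is `ψ(a)`. -/
theorem integral_log_gammaMeasure {a : ℝ} (ha : 0 < a) :
    ∫ t, Real.log t ∂(gammaMeasure a 1) = digamma a := by
  unfold gammaMeasure
  rw [integral_withDensity_eq_integral_toReal_smul (measurable_gammaPDF_one a)
    (ae_of_all _ fun _ => ENNReal.ofReal_lt_top)]
  simp only [gammaPDF_toReal_mul_log ha]
  rw [integral_indicator measurableSet_Ioi, integral_const_mul, digamma_eq ha]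

theorem gammaMeasure_ae_pos {a : ℝ} (ha : 0 < a) : ∀ᵐ t ∂(gammaMeasure a 1), 0 < t := by
  rw [ae_iff]
  have : {t : ℝ | ¬ 0 < t} = Set.Iic 0 := by ext; simp
  rw [this, gammaMeasure_apply ha measurableSet_Iic]
  have h0 : ∀ t ∈ Set.Ioi (0 : ℝ),
      t ^ (a - 1) * (Set.Iic (0 : ℝ)).indicator (fun t => Real.exp (-t)) t = (0 : ℝ) := by
    intro t ht
    rw [Set.indicator_of_notMem (by simpa using ht), mul_zero]
  rw [setIntegral_congr_fun measurableSet_Ioi h0]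
  simp

/-! ### The law of the zero-forcing gain -/

theorem iidCN_map_precomp {ι κ : Type*} [Fintype ι] [Fintype κ] {e : ι → κ}
    (he : Function.Injective e) : (iidCN κ).map (fun z i => z (e i)) = iidCN ι := by
  have h := (iIndepFun_pi (μ := fun _ : κ => stdCN) (X := fun _ => (id : ℂ → ℂ))
    (fun _ => aemeasurable_id)).precomp he
  exact (h.hasLaw_pi (μ := fun _ => stdCN) fun i =>
    (measurePreserving_eval (fun _ : κ => stdCN) (e i)).hasLaw).map_eq

theorem measurable_inner_toLp {κ : Type*} [Fintype κ] (v : EuclideanSpace ℂ κ) :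
    Measurable (fun z : κ → ℂ => inner ℂ v (WithLp.toLp 2 z)) := by
  simp only [PiLp.inner_apply, RCLike.inner_apply]
  fun_prop

/-- Coordinates of an i.i.d. `CN(0, 1)` vector along an orthonormal family are i.i.d. -/
theorem map_iidCN_inner {ι κ : Type*} [Fintype ι] [Fintype κ] {b : ι → EuclideanSpace ℂ κ}
    (hb : Orthonormal ℂ b) :
    (iidCN κ).map (fun z i => inner ℂ (b i) (WithLp.toLp 2 z)) = iidCN ι := by
  classical
  have hcard : Fintype.card ι ≤ Fintype.card κ := by
    have := hb.linearIndependent.fintype_card_le_finrank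
    rwa [finrank_euclideanSpace] at this
  -- Relabelling the family by elements of `κ` lets it extend to a basis indexed by `κ`, hence to a
  -- square unitary matrix; the wanted coordinates are some of those of a unitary image.
  obtain ⟨e⟩ := Function.Embedding.nonempty_of_card_le hcard
  have hve : ∀ i, Function.extend e b 0 (e i) = b i := fun i => e.injective.extend_apply _ _ _
  have hv : Orthonormal ℂ ((Set.range e).domRestrict (Function.extend e b 0)) := by
    have hcomp := hb.comp (Equiv.ofInjective e e.injective).symm (Equiv.injective _)
    convert hcomp using 1
    funext x
    obtain ⟨x, i, rfl⟩ := x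
    change Function.extend e b 0 (e i) = _
    rw [hve, Function.comp_apply, Equiv.ofInjective_symm_apply]
  obtain ⟨B, hB⟩ := hv.exists_orthonormalBasis_extension_of_card_eq (finrank_euclideanSpace)
  set Q : Matrix κ κ ℂ := Matrix.of fun k j => star (B k j) with hQ
  have hQU : Q ∈ Matrix.unitaryGroup κ ℂ := by
    rw [Matrix.mem_unitaryGroup_iff]
    ext k l
    have := orthonormal_iff_ite.1 B.orthonormal k l
    rw [Matrix.one_apply, ← this, Matrix.mul_apply, PiLp.inner_apply]
    refine Finset.sum_congr rfl fun j _ => ?_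
    simp only [hQ, Matrix.star_apply, Matrix.of_apply, RCLike.inner_apply,
      RCLike.star_def, Complex.conj_conj]
    ring
  have hQv : ∀ z k, (Q *ᵥ z) k = inner ℂ (B k) (WithLp.toLp 2 z) := by
    intro z k
    rw [PiLp.inner_apply]
    refine Finset.sum_congr rfl fun j _ => ?_
    simp only [hQ, Matrix.of_apply, RCLike.inner_apply, RCLike.star_def]
    ring
  have hQm : Measurable (fun z : κ → ℂ => Q *ᵥ z) :=
    measurable_pi_iff.2 fun k => by simpa only [hQv] using measurable_inner_toLp (B k)
  have hcomp : (fun z (i : ι) => inner ℂ (b i) (WithLp.toLp 2 z))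
      = (fun z i => z (e i)) ∘ (fun z : κ → ℂ => Q *ᵥ z) := by
    funext z i
    rw [Function.comp_apply, hQv, hB (e i) ⟨i, rfl⟩, hve]
  rw [hcomp, ← Measure.map_map (by fun_prop) hQm, map_iidCN_mulVec hQU,
    iidCN_map_precomp e.injective]

theorem measurable_norm_sq_proj {κ : Type*} [Fintype κ] (V : Submodule ℂ (EuclideanSpace ℂ κ)) :
    Measurable (fun z : κ → ℂ => ‖V.starProjection (WithLp.toLp 2 z)‖ ^ 2) :=
  ((V.starProjection.continuous.comp (PiLp.continuous_toLp 2 (fun _ : κ => ℂ))).norm.pow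
    2).measurable

/-- The squared norm of the projection of an i.i.d. `CN(0, 1)` vector onto a subspace of dimension
`d` is `Gamma(d, 1)`. -/
theorem map_norm_sq_proj_iidCN {κ : Type*} [Fintype κ] (V : Submodule ℂ (EuclideanSpace ℂ κ))
    (hV : 0 < Module.finrank ℂ V) :
    (iidCN κ).map (fun z => ‖V.starProjection (WithLp.toLp 2 z)‖ ^ 2)
      = gammaMeasure (Module.finrank ℂ V) 1 := by
  set b := stdOrthonormalBasis ℂ V with hb
  have horth : Orthonormal ℂ (fun i => (b i : EuclideanSpace ℂ κ)) :=
    b.orthonormal.comp_linearIsometry V.subtypeₗᵢ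
  have hm : Measurable (fun (z : κ → ℂ) i =>
      inner ℂ (b i : EuclideanSpace ℂ κ) (WithLp.toLp 2 z)) :=
    measurable_pi_iff.2 fun i => measurable_inner_toLp _
  rw [← map_sum_sq_iidCN hV, ← map_iidCN_inner horth, Measure.map_map (by fun_prop) hm]
  congr 1
  funext z
  rw [Function.comp_apply, Submodule.starProjection_apply, ← Submodule.coe_norm,
    ← b.sum_sq_norm_inner_right]
  refine Finset.sum_congr rfl fun i _ => ?_
  rw [Submodule.inner_orthogonalProjectionOnto_eq_of_mem_left]

theorem iidCN_ae_notMem {κ : Type*} [Fintype κ] {W : Submodule ℂ (κ → ℂ)} (hW : W ≠ ⊤) :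
    ∀ᵐ z ∂(iidCN κ), z ∉ W := by
  have h := Measure.addHaar_submodule (volume : Measure (κ → ℂ)) (W.restrictScalars ℝ) (by
    intro h
    exact hW (by simpa using h))
  have h2 : ∀ᵐ z ∂(volume : Measure (κ → ℂ)), z ∉ W := by
    rw [ae_iff]
    simpa using h
  exact (volume_absolutelyContinuous_iidCN κ).ae_le h2

/-- Given `n < K` independent columns, their span is a proper subspace, which a fresh independent
Gaussian column almost surely avoids. -/
theorem ae_linearIndependent (K : ℕ) : ∀ n : ℕ, n ≤ K →
    ∀ᵐ C ∂(Measure.pi fun _ : Fin n => iidCN (Fin K)), LinearIndependent ℂ C := by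
  intro n
  induction n with
  | zero => exact fun _ => ae_of_all _ fun C => linearIndependent_empty_type
  | succ n ih =>
    intro hn
    have hmp := measurePreserving_piFinSuccAbove (fun _ : Fin (n + 1) => iidCN (Fin K)) 0
    have hmeas : MeasurableSet {x : (Fin K → ℂ) × (Fin n → Fin K → ℂ) |
        LinearIndependent ℂ (Fin.cons x.1 x.2 : Fin (n + 1) → Fin K → ℂ)} := by
      refine (isOpen_setOfPred_linearIndependent.preimage ?_).measurableSet
      fun_prop
    have hprod : ∀ᵐ x ∂((iidCN (Fin K)).prod (Measure.pi fun _ : Fin n => iidCN (Fin K))),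
        LinearIndependent ℂ (Fin.cons x.1 x.2 : Fin (n + 1) → Fin K → ℂ) := by
      rw [Measure.ae_prod_iff_ae_ae hmeas, Measure.ae_ae_comm hmeas]
      filter_upwards [ih (by omega)] with B hB
      have hW : Submodule.span ℂ (Set.range B) ≠ ⊤ := by
        intro h
        have h1 := finrank_span_eq_card hB
        rw [h, finrank_top, Module.finrank_fin_fun, Fintype.card_fin] at h1
        omega
      filter_upwards [iidCN_ae_notMem hW] with a ha
      exact linearIndependent_finCons.2 ⟨hB, ha⟩
    filter_upwards [hmp.quasiMeasurePreserving.ae hprod] with C hC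
    have : (Fin.cons (C 0) (fun j => C ((0 : Fin (n + 1)).succAbove j)) :
        Fin (n + 1) → Fin K → ℂ) = C := by
      funext i
      refine Fin.cases rfl (fun j => ?_) i
      simp
    change LinearIndependent ℂ (Fin.cons (C 0) (fun j => C ((0 : Fin (n + 1)).succAbove j)) :
        Fin (n + 1) → Fin K → ℂ) at hC
    rwa [this] at hC

/-- Condition on the other `n` columns, whose span almost surely has dimension `n`. The gain is the
squared projection of the independent `m`-th column onto a complement of dimension `K - n`; its
conditional law is the same for almost all such columns, hence is the unconditional law. -/
theorem map_zfGain_pi {K n : ℕ} (hn : n < K) (m : Fin (n + 1)) :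
    (Measure.pi fun _ : Fin (n + 1) => iidCN (Fin K)).map
      (fun C => zfGain (Matrix.of C)ᵀ m) = gammaMeasure ((K - n : ℕ) : ℝ) 1 := by
  set e := MeasurableEquiv.piFinSuccAbove (fun _ : Fin (n + 1) => (Fin K → ℂ)) m with he
  have hmp := measurePreserving_piFinSuccAbove (fun _ : Fin (n + 1) => iidCN (Fin K)) m
  have hmp' := hmp.symm
  set g : (Fin (n + 1) → Fin K → ℂ) → ℝ := fun C => zfGain (Matrix.of C)ᵀ m with hg
  have hgm : Measurable g := measurable_zfGain m
  have hge : Measurable (fun x => g (e.symm x)) := hgm.comp e.symm.measurable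
  have hmap : (Measure.pi fun _ : Fin (n + 1) => iidCN (Fin K)).map g
      = ((iidCN (Fin K)).prod (Measure.pi fun _ : Fin n => iidCN (Fin K))).map
        (fun x => g (e.symm x)) := by
    rw [← hmp'.map_eq, Measure.map_map hgm e.symm.measurable]
    rfl
  have hLImeas : MeasurableSet {x : (Fin K → ℂ) × (Fin n → Fin K → ℂ) |
      LinearIndependent ℂ (e.symm x)} :=
    e.symm.measurable isOpen_setOfPred_linearIndependent.measurableSet
  have hLI : ∀ᵐ x ∂((iidCN (Fin K)).prod (Measure.pi fun _ : Fin n => iidCN (Fin K))),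
      LinearIndependent ℂ (e.symm x) :=
    hmp'.quasiMeasurePreserving.ae (ae_linearIndependent K (n + 1) hn)
  rw [Measure.ae_prod_iff_ae_ae hLImeas, Measure.ae_ae_comm hLImeas] at hLI
  rw [hmap]
  have hpos : (0 : ℝ) < ((K - n : ℕ) : ℝ) := by
    have : 0 < K - n := by omega
    exact_mod_cast this
  ext s hs
  rw [Measure.map_apply hge hs, Measure.prod_apply_symm (hge hs)]
  have hae : ∀ᵐ B ∂(Measure.pi fun _ : Fin n => iidCN (Fin K)),
      iidCN (Fin K) ((fun a => (a, B)) ⁻¹' ((fun x => g (e.symm x)) ⁻¹' s))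
        = gammaMeasure ((K - n : ℕ) : ℝ) 1 s := by
    filter_upwards [hLI, ae_linearIndependent K n hn.le] with B hB hBLI
    set W : Submodule ℂ (EuclideanSpace ℂ (Fin K)) :=
      Submodule.span ℂ (Set.range fun j => WithLp.toLp 2 (B j)) with hW
    have hWrank : Module.finrank ℂ W = n := by
      have hli : LinearIndependent ℂ
          (fun j => (WithLp.toLp 2 (B j) : EuclideanSpace ℂ (Fin K))) :=
        hBLI.map' (WithLp.linearEquiv 2 ℂ (Fin K → ℂ)).symm.toLinearMap
          (LinearEquiv.ker _)
      rw [hW, finrank_span_eq_card hli, Fintype.card_fin]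
    have hrank : Module.finrank ℂ Wᗮ = K - n := by
      have := W.finrank_add_finrank_orthogonal
      rw [hWrank, finrank_euclideanSpace, Fintype.card_fin] at this
      omega
    have hlaw := map_norm_sq_proj_iidCN Wᗮ (by omega)
    rw [hrank] at hlaw
    rw [← hlaw, Measure.map_apply (measurable_norm_sq_proj _) hs]
    refine measure_congr ?_
    filter_upwards [hB] with a ha
    have hgain : g (e.symm (a, B)) = ‖Wᗮ.starProjection (WithLp.toLp 2 a)‖ ^ 2 := by
      have hcol : (Matrix.of (e.symm (a, B)))ᵀ.col = e.symm (a, B) := rfl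
      have hsymm : e.symm (a, B) = Fin.insertNth m a B := rfl
      have h := zfGain_eq_norm_proj ((Matrix.of (e.symm (a, B)))ᵀ) (by rw [hcol]; exact ha) m W (by
        rw [hW, hcol, hsymm]
        congr 1
        ext v
        constructor
        · rintro ⟨j, rfl⟩
          exact ⟨m.succAbove j, Fin.succAbove_ne m j, by simp⟩
        · rintro ⟨j, hj, rfl⟩
          obtain ⟨i, rfl⟩ := Fin.exists_succAbove_eq hj
          exact ⟨i, by simp⟩)
      rw [hcol, hsymm, Fin.insertNth_apply_same] at h
      rw [← h]
      rfl
    have : (g (e.symm (a, B)) ∈ s) = (‖Wᗮ.starProjection (WithLp.toLp 2 a)‖ ^ 2 ∈ s) := by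
      rw [hgain]
    exact this
  rw [lintegral_congr_ae hae, lintegral_const, measure_univ, mul_one]

theorem map_iidCN_of_isometry' {ι : Type*} [Fintype ι] (f : (ι → ℂ) →ₗ[ℝ] (ι → ℂ))
    (hf : ∀ z, ∑ i, ‖f z i‖ ^ 2 = ∑ i, ‖z i‖ ^ 2) :
    (iidCN ι).map f = iidCN ι := by
  have hinj : Function.Injective f := by
    rw [injective_iff_map_eq_zero]
    intro z hz
    have h := hf z
    rw [hz] at h
    simp only [Pi.zero_apply, norm_zero, ne_eq, OfNat.ofNat_ne_zero, not_false_eq_true, zero_pow,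
      Finset.sum_const_zero] at h
    funext i
    have := (Finset.sum_eq_zero_iff_of_nonneg (fun i _ => by positivity)).1 h.symm i
      (Finset.mem_univ i)
    simpa using this
  exact map_iidCN_of_isometry (LinearEquiv.ofInjectiveEndo f hinj) hf

/-- Right multiplication by `U` acts on each row of the channel through the unitary `Uᵀ`, so it
preserves the total squared norm. -/
theorem map_columns_mul_unitary {K M : ℕ} {U : Matrix (Fin M) (Fin M) ℂ}
    (hU : U ∈ Matrix.unitaryGroup (Fin M) ℂ) :
    (iidCN (Fin M × Fin K)).map (fun z (i : Fin M × Fin K) => ∑ l, z (l, i.2) * U l i.1)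
      = iidCN (Fin M × Fin K) := by
  have hUT : Uᵀ ∈ Matrix.unitaryGroup (Fin M) ℂ := by
    rw [Matrix.mem_unitaryGroup_iff, Matrix.star_eq_conjTranspose]
    have h := congrArg Matrix.transpose (Matrix.mem_unitaryGroup_iff'.1 hU)
    rw [Matrix.transpose_mul, Matrix.transpose_one, Matrix.star_eq_conjTranspose] at h
    exact h
  let f : (Fin M × Fin K → ℂ) →ₗ[ℝ] (Fin M × Fin K → ℂ) :=
    { toFun := fun z i => ∑ l, z (l, i.2) * U l i.1
      map_add' := fun x y => by
        funext i
        simp only [Pi.add_apply, add_mul, Finset.sum_add_distrib]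
      map_smul' := fun r x => by
        funext i
        simp only [Pi.smul_apply, RingHom.id_apply, Finset.smul_sum, smul_mul_assoc] }
  refine map_iidCN_of_isometry' f fun z => ?_
  rw [Fintype.sum_prod_type_right, Fintype.sum_prod_type_right]
  refine Finset.sum_congr rfl fun k _ => ?_
  rw [← sum_norm_sq_mulVec hUT (fun j => z (j, k))]
  refine Finset.sum_congr rfl fun j _ => ?_
  have h : f z (j, k) = (Uᵀ *ᵥ fun j => z (j, k)) j := by
    change ∑ l, z (l, k) * U l j = ∑ l, Uᵀ j l * z (l, k)
    exact Finset.sum_congr rfl fun l _ => mul_comm _ _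
  rw [h]

/-- The zero-forcing gain of a Rayleigh channel is `Gamma(K - M + 1, 1)`. -/
theorem hasLaw_zfGain {Ω : Type*} [MeasurableSpace Ω] {μ : Measure Ω} {K M : ℕ} (hM : 0 < M)
    (hKM : M ≤ K) {U : Matrix (Fin M) (Fin M) ℂ} (hU : U ∈ Matrix.unitaryGroup (Fin M) ℂ)
    {H : Ω → Matrix (Fin K) (Fin M) ℂ} (hlaw : ∀ k j, HasLaw (fun ω => H ω k j) stdCN μ)
    (hind : iIndepFun (fun (i : Fin K × Fin M) ω => H ω i.1 i.2) μ) (m : Fin M) :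
    HasLaw (fun ω => zfGain (H ω * U) m) (gammaMeasure ((K : ℝ) - M + 1) 1) μ := by
  have h1 : HasLaw (fun ω (i : Fin M × Fin K) => H ω i.2 i.1) (iidCN (Fin M × Fin K)) μ :=
    (hind.precomp (g := fun i : Fin M × Fin K => (i.2, i.1)) (fun a b h => by
      simp only [Prod.mk.injEq] at h
      exact Prod.ext h.2 h.1)).hasLaw_pi (μ := fun _ => stdCN) fun i => hlaw i.2 i.1
  have hT : Measurable (fun (z : Fin M × Fin K → ℂ) (i : Fin M × Fin K) =>
      ∑ l, z (l, i.2) * U l i.1) := by fun_prop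
  have h2 := HasLaw.fun_comp (Y := fun (z : Fin M × Fin K → ℂ) (i : Fin M × Fin K) =>
    ∑ l, z (l, i.2) * U l i.1) ⟨hT.aemeasurable, map_columns_mul_unitary hU⟩ h1
  have h3 := HasLaw.fun_comp (Y := fun (z : Fin M × Fin K → ℂ) j k => z (j, k))
    ⟨(by fun_prop : Measurable fun (z : Fin M × Fin K → ℂ) j k => z (j, k)).aemeasurable,
      iidCN_map_curry (Fin M) (Fin K)⟩ h2
  obtain ⟨n, rfl⟩ : ∃ n, M = n + 1 := ⟨M - 1, by omega⟩
  have h4 := HasLaw.fun_comp (Y := fun C : Fin (n + 1) → Fin K → ℂ => zfGain (Matrix.of C)ᵀ m)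
    ⟨(measurable_zfGain m).aemeasurable, map_zfGain_pi (by omega) m⟩ h3
  have hcast : ((K - n : ℕ) : ℝ) = (K : ℝ) - (n + 1 : ℕ) + 1 := by
    rw [Nat.cast_sub (by omega)]
    push_cast
    ring
  rw [hcast] at h4
  exact h4

/-! ### The rate-profile problem -/

/-- Power allocations with total power at most `p`. -/
def powerSimplex (M : ℕ) (p : ℝ) : Set (Fin M → ℝ) := {q | ∑ m, q m ≤ p ∧ ∀ m, 0 ≤ q m}

theorem le_of_mem_powerSimplex {M : ℕ} {p : ℝ} {q : Fin M → ℝ} (hq : q ∈ powerSimplex M p)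
    (m : Fin M) : q m ≤ p :=
  (Finset.single_le_sum (fun i _ => hq.2 i) (Finset.mem_univ m)).trans hq.1

theorem isCompact_powerSimplex (M : ℕ) (p : ℝ) : IsCompact (powerSimplex M p) := by
  refine (isCompact_univ_pi fun _ : Fin M => isCompact_Icc (a := (0 : ℝ)) (b := p)).of_isClosed_subset
    ?_ fun q hq m _ => ⟨hq.2 m, le_of_mem_powerSimplex hq m⟩
  have h1 : IsClosed {q : Fin M → ℝ | ∑ m, q m ≤ p} :=
    isClosed_le (by fun_prop) continuous_const
  have h2 : IsClosed {q : Fin M → ℝ | ∀ m, 0 ≤ q m} := by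
    simp only [Set.ofPred_forall]
    exact isClosed_iInter fun m => isClosed_le continuous_const (continuous_apply m)
  exact h1.inter h2

theorem uniform_mem_powerSimplex {M : ℕ} (hM : 0 < M) {p : ℝ} (hp : 0 ≤ p) :
    (fun _ : Fin M => p / M) ∈ powerSimplex M p := by
  have hM' : (M : ℝ) ≠ 0 := by exact_mod_cast hM.ne'
  refine ⟨?_, fun _ => by positivity⟩
  simp only [Finset.sum_const, Finset.card_univ, Fintype.card_fin, nsmul_eq_mul]
  rw [mul_div_cancel₀ _ hM']

/-- The largest `r` with `α r ≤ x` and `(1 - α) r ≤ y`. -/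
noncomputable def profile (α x y : ℝ) : ℝ :=
  if α = 0 then y else if α = 1 then x else min (x / α) (y / (1 - α))

/-- Nonnegative rates make the constraint with zero weight vacuous at `α = 0` and `α = 1`. -/
theorem le_profile_iff {α x y r : ℝ} (hα : α ∈ Set.Icc (0 : ℝ) 1) (hx : 0 ≤ x) (hy : 0 ≤ y) :
    r ≤ profile α x y ↔ α * r ≤ x ∧ (1 - α) * r ≤ y := by
  unfold profile
  split_ifs with h0 h1
  · subst h0; simp [hx]
  · subst h1; simp [hy]
  · have ha : 0 < α := lt_of_le_of_ne hα.1 (Ne.symm h0)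
    have hb : 0 < 1 - α := sub_pos.2 (lt_of_le_of_ne hα.2 h1)
    rw [le_min_iff, le_div_iff₀ ha, le_div_iff₀ hb, mul_comm r, mul_comm r]

/-- Both increases must be strict, since either constraint alone may be the binding one. -/
theorem profile_lt_profile {α x y x' y' : ℝ} (hα : α ∈ Set.Icc (0 : ℝ) 1) (hx : x < x')
    (hy : y < y') : profile α x y < profile α x' y' := by
  unfold profile
  split_ifs with h0 h1
  · exact hy
  · exact hx
  · have ha : 0 < α := lt_of_le_of_ne hα.1 (Ne.symm h0)
    have hb : 0 < 1 - α := sub_pos.2 (lt_of_le_of_ne hα.2 h1)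
    exact min_lt_min (by gcongr) (by gcongr)

theorem continuous_profile (α : ℝ) : Continuous (fun x : ℝ × ℝ => profile α x.1 x.2) := by
  unfold profile
  split_ifs
  · fun_prop
  · fun_prop
  · fun_prop

/-- Agreement on nonnegative powers is all that is available, because the closed form of the sensing
rate involves `√q`. -/
theorem isOptimal_congr {M : ℕ} {Rs Rc Rs' Rc' : (Fin M → ℝ) → ℝ}
    (hs : ∀ q, (∀ m, 0 ≤ q m) → Rs q = Rs' q) (hc : ∀ q, (∀ m, 0 ≤ q m) → Rc q = Rc' q)
    (α p : ℝ) (q : Fin M → ℝ) : IsOptimal Rs Rc α p q ↔ IsOptimal Rs' Rc' α p q := by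
  have hF : ∀ q r, Feasible Rs Rc α p q r ↔ Feasible Rs' Rc' α p q r := by
    intro q r
    unfold Feasible
    constructor
    · rintro ⟨h1, h2, h3, h4⟩
      exact ⟨hs q h4 ▸ h1, hc q h4 ▸ h2, h3, h4⟩
    · rintro ⟨h1, h2, h3, h4⟩
      exact ⟨(hs q h4).symm ▸ h1, (hc q h4).symm ▸ h2, h3, h4⟩
  simp only [IsOptimal, hF]

section
variable {M : ℕ} {Rs Rc : (Fin M → ℝ) → ℝ} {α p : ℝ}

theorem isOptimal_iff (hα : α ∈ Set.Icc (0 : ℝ) 1)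
    (hRs : ∀ q ∈ powerSimplex M p, 0 ≤ Rs q) (hRc : ∀ q ∈ powerSimplex M p, 0 ≤ Rc q)
    (q : Fin M → ℝ) :
    IsOptimal Rs Rc α p q ↔ q ∈ powerSimplex M p ∧
      ∀ q' ∈ powerSimplex M p, profile α (Rs q') (Rc q') ≤ profile α (Rs q) (Rc q) := by
  have hF : ∀ q r, Feasible Rs Rc α p q r ↔
      q ∈ powerSimplex M p ∧ r ≤ profile α (Rs q) (Rc q) := by
    intro q r
    constructor
    · rintro ⟨h1, h2, h3⟩
      exact ⟨h3, (le_profile_iff hα (hRs q h3) (hRc q h3)).2 ⟨h1, h2⟩⟩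
    · rintro ⟨h3, h⟩
      have := (le_profile_iff hα (hRs q h3) (hRc q h3)).1 h
      exact ⟨this.1, this.2, h3⟩
  unfold IsOptimal
  simp only [hF]
  constructor
  · rintro ⟨r, ⟨hq, hr⟩, hmax⟩
    exact ⟨hq, fun q' hq' => (hmax q' _ ⟨hq', le_rfl⟩).trans hr⟩
  · rintro ⟨hq, hmax⟩
    exact ⟨_, ⟨hq, le_rfl⟩, fun q' r' h => h.2.trans (hmax q' h.1)⟩

theorem exists_isOptimal (hα : α ∈ Set.Icc (0 : ℝ) 1) (hp : 0 ≤ p)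
    (hRs : ∀ q ∈ powerSimplex M p, 0 ≤ Rs q) (hRc : ∀ q ∈ powerSimplex M p, 0 ≤ Rc q)
    (hsc : ContinuousOn Rs (powerSimplex M p)) (hcc : ContinuousOn Rc (powerSimplex M p)) :
    ∃ q, IsOptimal Rs Rc α p q := by
  have hne : (powerSimplex M p).Nonempty := ⟨0, by simpa using hp, fun _ => le_rfl⟩
  obtain ⟨q, hq, hmax⟩ := (isCompact_powerSimplex M p).exists_isMaxOn hne
    ((continuous_profile α).comp_continuousOn (hsc.prodMk hcc))
  exact ⟨q, (isOptimal_iff hα hRs hRc q).2 ⟨hq, fun q' hq' => hmax hq'⟩⟩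

/-- Two distinct optima share the optimal `r`, so the minima of their rates still support it; their
midpoint is feasible and strictly exceeds both minima, hence supports a larger `r`. -/
theorem isOptimal_unique (hα : α ∈ Set.Icc (0 : ℝ) 1)
    (hRs : ∀ q ∈ powerSimplex M p, 0 ≤ Rs q) (hRc : ∀ q ∈ powerSimplex M p, 0 ≤ Rc q)
    (hsm : ∀ q₁ ∈ powerSimplex M p, ∀ q₂ ∈ powerSimplex M p, q₁ ≠ q₂ →
      min (Rs q₁) (Rs q₂) < Rs (fun m => (q₁ m + q₂ m) / 2))
    (hcm : ∀ q₁ ∈ powerSimplex M p, ∀ q₂ ∈ powerSimplex M p, q₁ ≠ q₂ →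
      min (Rc q₁) (Rc q₂) < Rc (fun m => (q₁ m + q₂ m) / 2))
    {q₁ q₂ : Fin M → ℝ} (h₁ : IsOptimal Rs Rc α p q₁) (h₂ : IsOptimal Rs Rc α p q₂) :
    q₁ = q₂ := by
  rw [isOptimal_iff hα hRs hRc] at h₁ h₂
  by_contra hne
  have hmid : (fun m => (q₁ m + q₂ m) / 2) ∈ powerSimplex M p := by
    refine ⟨?_, fun m => by have := h₁.1.2 m; have := h₂.1.2 m; positivity⟩
    rw [← Finset.sum_div, Finset.sum_add_distrib]
    have := h₁.1.1
    have := h₂.1.1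
    linarith
  have hlt := profile_lt_profile hα (hsm q₁ h₁.1 q₂ h₂.1 hne) (hcm q₁ h₁.1 q₂ h₂.1 hne)
  have e1 := (le_profile_iff hα (hRs _ h₁.1) (hRc _ h₁.1)).1 le_rfl
  have e2 := (le_profile_iff hα (hRs _ h₂.1) (hRc _ h₂.1)).1 (h₂.2 q₁ h₁.1)
  have hle : profile α (Rs q₁) (Rc q₁) ≤ profile α (min (Rs q₁) (Rs q₂)) (min (Rc q₁) (Rc q₂)) :=
    (le_profile_iff hα (le_min (hRs _ h₁.1) (hRs _ h₂.1)) (le_min (hRc _ h₁.1) (hRc _ h₂.1))).2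
      ⟨le_min e1.1 e2.1, le_min e1.2 e2.2⟩
  exact absurd (h₁.2 _ hmid) (not_le.2 (hle.trans_lt hlt))

/-- Weak Pareto optimality; with `u` uniform, this is the only consequence of optimality that the
asymptotics use. -/
theorem IsOptimal.le_or_le (hα : α ∈ Set.Icc (0 : ℝ) 1)
    (hRs : ∀ q ∈ powerSimplex M p, 0 ≤ Rs q) (hRc : ∀ q ∈ powerSimplex M p, 0 ≤ Rc q)
    {q u : Fin M → ℝ} (hq : IsOptimal Rs Rc α p q) (hu : u ∈ powerSimplex M p) :
    Rs u ≤ Rs q ∨ Rc u ≤ Rc q := by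
  rw [isOptimal_iff hα hRs hRc] at hq
  by_contra! h
  exact absurd (hq.2 u hu) (not_le.2 (profile_lt_profile hα h.1 h.2))

end

/-! ### Sum rates of parallel channels -/

/-- The sum rate of parallel Gaussian channels with gains `b` and powers `q`. -/
noncomputable def sumRate {M : ℕ} (b q : Fin M → ℝ) : ℝ := ∑ m, Real.logb 2 (1 + b m * q m)

section
variable {M : ℕ} {b q : Fin M → ℝ} {p : ℝ}

theorem one_le_one_add_mul (hb : ∀ m, 0 < b m) (hq : ∀ m, 0 ≤ q m) (m : Fin M) :
    1 ≤ 1 + b m * q m := by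
  have := mul_nonneg (hb m).le (hq m); linarith

theorem sumRate_nonneg (hb : ∀ m, 0 < b m) (hq : ∀ m, 0 ≤ q m) : 0 ≤ sumRate b q :=
  Finset.sum_nonneg fun m _ => Real.logb_nonneg one_lt_two (one_le_one_add_mul hb hq m)

theorem sumRate_eq_log (b q : Fin M → ℝ) :
    sumRate b q = (∑ m, Real.log (1 + b m * q m)) / Real.log 2 := by
  simp only [sumRate, Real.logb, Finset.sum_div]

theorem log_add_log_le_two_mul {x y : ℝ} (hx : 0 < x) (hy : 0 < y) :
    Real.log x + Real.log y ≤ 2 * Real.log ((x + y) / 2) := by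
  rw [← Real.log_mul hx.ne' hy.ne', ← Nat.cast_two (R := ℝ), ← Real.log_pow]
  refine Real.log_le_log (by positivity) ?_
  push_cast
  nlinarith [sq_nonneg (x - y)]

theorem log_add_log_lt_two_mul {x y : ℝ} (hx : 0 < x) (hy : 0 < y) (h : x ≠ y) :
    Real.log x + Real.log y < 2 * Real.log ((x + y) / 2) := by
  rw [← Real.log_mul hx.ne' hy.ne', ← Nat.cast_two (R := ℝ), ← Real.log_pow]
  refine Real.log_lt_log (by positivity) ?_
  push_cast
  have := sq_pos_of_ne_zero (sub_ne_zero.2 h)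
  nlinarith

/-- Strict concavity of the logarithm in a coordinate where the allocations differ, whose gain is
positive. -/
theorem min_sumRate_lt_midpoint (hb : ∀ m, 0 < b m) {q₁ q₂ : Fin M → ℝ} (h₁ : ∀ m, 0 ≤ q₁ m)
    (h₂ : ∀ m, 0 ≤ q₂ m) (hne : q₁ ≠ q₂) :
    min (sumRate b q₁) (sumRate b q₂) < sumRate b (fun m => (q₁ m + q₂ m) / 2) := by
  have hlog2 : (0 : ℝ) < Real.log 2 := Real.log_pos one_lt_two
  have hpos₁ := fun m => zero_lt_one.trans_le (one_le_one_add_mul hb h₁ m)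
  have hpos₂ := fun m => zero_lt_one.trans_le (one_le_one_add_mul hb h₂ m)
  have hmid : ∀ m, 1 + b m * ((q₁ m + q₂ m) / 2)
      = ((1 + b m * q₁ m) + (1 + b m * q₂ m)) / 2 := fun m => by ring
  have hsum : ∑ m, (Real.log (1 + b m * q₁ m) + Real.log (1 + b m * q₂ m))
      < ∑ m, 2 * Real.log (1 + b m * ((q₁ m + q₂ m) / 2)) := by
    simp only [hmid]
    obtain ⟨m, hm⟩ := Function.ne_iff.1 hne
    refine Finset.sum_lt_sum (fun m _ => log_add_log_le_two_mul (hpos₁ m) (hpos₂ m))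
      ⟨m, Finset.mem_univ m, log_add_log_lt_two_mul (hpos₁ m) (hpos₂ m) fun h => hm ?_⟩
    exact mul_left_cancel₀ (hb m).ne' (add_left_cancel h)
  rw [Finset.sum_add_distrib, ← Finset.mul_sum] at hsum
  have h : sumRate b q₁ + sumRate b q₂ < 2 * sumRate b (fun m => (q₁ m + q₂ m) / 2) := by
    rw [sumRate_eq_log, sumRate_eq_log, sumRate_eq_log, ← add_div, ← mul_div_assoc]
    exact div_lt_div_of_pos_right hsum hlog2
  rcases min_le_iff.1 (le_refl (min (sumRate b q₁) (sumRate b q₂))) with h' | h' <;>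
    · have := min_le_left (sumRate b q₁) (sumRate b q₂)
      have := min_le_right (sumRate b q₁) (sumRate b q₂)
      linarith

theorem continuousOn_sumRate (b : Fin M → ℝ) (hb : ∀ m, 0 < b m) (p : ℝ) :
    ContinuousOn (sumRate b) (powerSimplex M p) := by
  simp only [funext (sumRate_eq_log b)]
  refine ContinuousOn.div_const (continuousOn_finsetSum _ fun m _ => ?_) _
  refine ContinuousOn.log (by fun_prop) fun q hq => ?_
  exact (zero_lt_one.trans_le (one_le_one_add_mul hb hq.2 m)).ne'

/-- If the rate of `q` is at least the rate of the uniform allocation, then `q` is close to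
uniform. -/
theorem sq_sqrt_sub_one_le (hM : 0 < M) (hb : ∀ m, 0 < b m) (hp : 0 < p)
    (hq : q ∈ powerSimplex M p) (hle : sumRate b (fun _ => p / M) ≤ sumRate b q) (m : Fin M) :
    (√((1 + b m * q m) / (1 + b m * (p / M))) - 1) ^ 2 ≤ M / p * ∑ j, (b j)⁻¹ := by
  have hM' : (0 : ℝ) < M := by exact_mod_cast hM
  have hlog2 : (0 : ℝ) < Real.log 2 := Real.log_pos one_lt_two
  have hu : ∀ j, 0 < 1 + b j * (p / M) := fun j => by have := hb j; positivity
  have hv : ∀ j, 0 < 1 + b j * q j := fun j =>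
    zero_lt_one.trans_le (one_le_one_add_mul hb hq.2 j)
  -- The rate hypothesis says `∑ log t_j ≥ 0`, and the power budget gives `∑ (t_j - 1) = O(1 / p)`.
  -- So the nonnegative deficits `t_j - 1 - log t_j` are all small.
  set t : Fin M → ℝ := fun j => (1 + b j * q j) / (1 + b j * (p / M)) with ht
  have htpos : ∀ j, 0 < t j := fun j => div_pos (hv j) (hu j)
  have hlogsum : 0 ≤ ∑ j, Real.log (t j) := by
    simp only [ht]
    simp only [Real.log_div (hv _).ne' (hu _).ne', Finset.sum_sub_distrib]
    rw [sumRate_eq_log, sumRate_eq_log, div_le_div_iff_of_pos_right hlog2] at hle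
    linarith
  have hkey : ∀ j, ((b j)⁻¹ + p / M) * (t j - 1) = q j - p / M := by
    intro j
    have h1 := (hu j).ne'
    have h2 := (hb j).ne'
    simp only [ht]
    rw [div_sub_one h1, mul_div_assoc', div_eq_iff h1]
    field_simp
    ring
  have hsum : ∑ j, (t j - 1) ≤ M / p * ∑ j, (b j)⁻¹ := by
    have h1 : ∑ j, ((b j)⁻¹ + p / M) * (t j - 1) ≤ 0 := by
      simp only [hkey, Finset.sum_sub_distrib, Finset.sum_const, Finset.card_univ,
        Fintype.card_fin, nsmul_eq_mul]
      rw [mul_div_cancel₀ _ hM'.ne']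
      linarith [hq.1]
    have h2 : ∑ j, ((b j)⁻¹ + p / M) * (t j - 1)
        = ∑ j, (b j)⁻¹ * t j - ∑ j, (b j)⁻¹ + p / M * ∑ j, (t j - 1) := by
      rw [Finset.mul_sum, ← Finset.sum_sub_distrib, ← Finset.sum_add_distrib]
      exact Finset.sum_congr rfl fun j _ => by ring
    have h3 : 0 ≤ ∑ j, (b j)⁻¹ * t j :=
      Finset.sum_nonneg fun j _ => mul_nonneg (inv_pos.2 (hb j)).le (htpos j).le
    have h4 : p / M * ∑ j, (t j - 1) ≤ ∑ j, (b j)⁻¹ := by linarith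
    calc ∑ j, (t j - 1) = M / p * (p / M * ∑ j, (t j - 1)) := by field_simp
      _ ≤ _ := by gcongr
  -- From `log t = 2 log √t ≤ 2 (√t - 1)`.
  have hterm : ∀ j, (√(t j) - 1) ^ 2 ≤ t j - 1 - Real.log (t j) := by
    intro j
    have h1 := Real.log_le_sub_one_of_pos (Real.sqrt_pos.2 (htpos j))
    rw [Real.log_sqrt (htpos j).le] at h1
    nlinarith [Real.sq_sqrt (htpos j).le]
  calc (√(t m) - 1) ^ 2 ≤ ∑ j, (√(t j) - 1) ^ 2 :=
        Finset.single_le_sum (f := fun j => (√(t j) - 1) ^ 2) (fun j _ => sq_nonneg _)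
          (Finset.mem_univ m)
    _ ≤ ∑ j, (t j - 1 - Real.log (t j)) := Finset.sum_le_sum fun j _ => hterm j
    _ = ∑ j, (t j - 1) - ∑ j, Real.log (t j) := by rw [Finset.sum_sub_distrib]
    _ ≤ _ := by linarith

/-- Deviation of the normalized powers from the uniform allocation. -/
noncomputable def powerError (b : Fin M → ℝ) (m : Fin M) (p : ℝ) : ℝ :=
  √(M / p * ∑ j, (b j)⁻¹) * (2 + √(M / p * ∑ j, (b j)⁻¹)) * ((b m)⁻¹ / p + 1 / M)

/-- With `|√t - 1| ≤ √d`, factoring `t - 1 = (√t - 1) (√t + 1)` gives `√d (2 + √d)`; the last factor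
of `powerError` converts `t - 1` into `q_m / p - 1 / M`. -/
theorem abs_div_sub_le_powerError (hM : 0 < M) (hb : ∀ m, 0 < b m) (hp : 0 < p)
    (hq : q ∈ powerSimplex M p) (hle : sumRate b (fun _ => p / M) ≤ sumRate b q) (m : Fin M) :
    |q m / p - 1 / M| ≤ powerError b m p := by
  have hM' : (0 : ℝ) < M := by exact_mod_cast hM
  have h := sq_sqrt_sub_one_le hM hb hp hq hle m
  have hu : 0 < 1 + b m * (p / M) := by have := hb m; positivity
  have hv : 0 < 1 + b m * q m := zero_lt_one.trans_le (one_le_one_add_mul hb hq.2 m)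
  have hbm := hb m
  unfold powerError
  set d : ℝ := M / p * ∑ j, (b j)⁻¹
  set t : ℝ := (1 + b m * q m) / (1 + b m * (p / M)) with ht
  have htpos : 0 < t := div_pos hv hu
  have habs : |√t - 1| ≤ √d := Real.abs_le_sqrt h
  have hst : √t + 1 ≤ 2 + √d := by linarith [(abs_le.1 habs).2]
  have ht1 : |t - 1| ≤ √d * (2 + √d) := by
    have : t - 1 = (√t - 1) * (√t + 1) := by nlinarith [Real.sq_sqrt htpos.le]
    rw [this, abs_mul, abs_of_nonneg (by positivity : (0 : ℝ) ≤ √t + 1)]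
    gcongr
  have hq' : q m / p - 1 / M = (t - 1) * ((b m)⁻¹ / p + 1 / M) := by
    rw [ht, div_sub_one hu.ne', div_mul_eq_mul_div, eq_div_iff hu.ne']
    field_simp
    ring
  rw [hq', abs_mul, abs_of_nonneg (by positivity : (0 : ℝ) ≤ (b m)⁻¹ / p + 1 / M)]
  gcongr

theorem powerError_nonneg (hb : ∀ m, 0 < b m) (hp : 0 < p) (m : Fin M) :
    0 ≤ powerError b m p := by
  have := (inv_pos.2 (hb m)).le
  unfold powerError
  positivity

theorem tendsto_powerError (b : Fin M → ℝ) (m : Fin M) :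
    Tendsto (powerError b m) atTop (𝓝 0) := by
  have h1 : Tendsto (fun p : ℝ => √(M / p * ∑ j, (b j)⁻¹)) atTop (𝓝 0) := by
    have : Tendsto (fun p : ℝ => (M : ℝ) / p * ∑ j, (b j)⁻¹) atTop (𝓝 (0 * ∑ j, (b j)⁻¹)) :=
      (tendsto_const_nhds.div_atTop tendsto_id).mul_const _
    rw [zero_mul] at this
    simpa using this.sqrt
  have h2 : Tendsto (fun p : ℝ => (b m)⁻¹ / p + 1 / (M : ℝ)) atTop (𝓝 (0 + 1 / (M : ℝ))) :=
    (tendsto_const_nhds.div_atTop tendsto_id).add_const _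
  have := (h1.mul (h1.const_add 2)).mul h2
  rw [zero_mul, zero_mul] at this
  exact this

/-- Bound on the deviation of `log (1 + b_m q_m)` from `log p`. -/
noncomputable def logBound (b : Fin M → ℝ) : ℝ :=
  ∑ j, (2 * |Real.log (b j)| + Real.log 2 + Real.log M)

theorem log_one_add_le {x : ℝ} (hx : 0 < x) : Real.log (1 + x) ≤ Real.log 2 + |Real.log x| := by
  rcases le_total x 1 with h | h
  · have : Real.log (1 + x) ≤ Real.log 2 := Real.log_le_log (by linarith) (by linarith)
    linarith [abs_nonneg (Real.log x)]
  · have : Real.log (1 + x) ≤ Real.log (2 * x) := Real.log_le_log (by linarith) (by linarith)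
    rw [Real.log_mul two_ne_zero hx.ne'] at this
    linarith [le_abs_self (Real.log x)]

theorem log_one_add_mul_le {c x p : ℝ} (hc : 0 < c) (hx0 : 0 ≤ x) (hx : x ≤ p) (hp : 1 ≤ p) :
    Real.log (1 + c * x) ≤ Real.log p + Real.log (1 + c) := by
  rw [← Real.log_mul (by positivity) (by positivity)]
  refine Real.log_le_log (by positivity) ?_
  nlinarith [mul_le_mul_of_nonneg_left hx hc.le]

theorem logBound_term_nonneg (b : Fin M → ℝ) (j : Fin M) :
    0 ≤ 2 * |Real.log (b j)| + Real.log 2 + Real.log M := by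
  have := Real.log_nonneg one_le_two
  have := Real.log_natCast_nonneg M
  positivity

theorem le_logBound (b : Fin M → ℝ) (m : Fin M) :
    2 * |Real.log (b m)| + Real.log 2 + Real.log M ≤ logBound b :=
  Finset.single_le_sum (f := fun j => 2 * |Real.log (b j)| + Real.log 2 + Real.log M)
    (fun j _ => logBound_term_nonneg b j) (Finset.mem_univ m)

/-- Above, `q_m ≤ p` suffices. Below, the total is at least that of the uniform allocation while
each other term is at most `log p` plus a constant, so the `m`-th cannot lag far behind. -/
theorem abs_log_one_add_sub_le_logBound (hM : 0 < M) (hb : ∀ m, 0 < b m) (hp : 1 ≤ p)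
    (hq : q ∈ powerSimplex M p) (hle : sumRate b (fun _ => p / M) ≤ sumRate b q) (m : Fin M) :
    |Real.log (1 + b m * q m) - Real.log p| ≤ logBound b := by
  have hM' : (0 : ℝ) < M := by exact_mod_cast hM
  have hp0 : 0 < p := by linarith
  have hlog2 : (0 : ℝ) < Real.log 2 := Real.log_pos one_lt_two
  have hup : ∀ j, Real.log (1 + b j * q j) ≤ Real.log p + Real.log (1 + b j) := fun j =>
    log_one_add_mul_le (hb j) (hq.2 j) (le_of_mem_powerSimplex hq j) hp
  have hlogM : 0 ≤ Real.log M := Real.log_natCast_nonneg M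
  rw [abs_le]
  constructor
  · rw [sumRate_eq_log, sumRate_eq_log, div_le_div_iff_of_pos_right hlog2] at hle
    have hlow : ∀ j, Real.log p + Real.log (b j) - Real.log M ≤ Real.log (1 + b j * (p / M)) := by
      intro j
      have hbj := hb j
      rw [← Real.log_mul hp0.ne' (hb j).ne', ← Real.log_div (by positivity) hM'.ne']
      refine Real.log_le_log (by positivity) ?_
      have : p * b j / M = b j * (p / M) := by ring
      linarith
    have h1 : ∑ j, (Real.log p + Real.log (b j) - Real.log M)
        ≤ ∑ j, Real.log (1 + b j * q j) := (Finset.sum_le_sum fun j _ => hlow j).trans hle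
    have h2 : ∑ j ∈ Finset.univ.erase m, Real.log (1 + b j * q j)
        ≤ ∑ j ∈ Finset.univ.erase m, (Real.log p + Real.log (1 + b j)) :=
      Finset.sum_le_sum fun j _ => hup j
    have h3 := Finset.add_sum_erase Finset.univ (fun j => Real.log (1 + b j * q j))
      (Finset.mem_univ m)
    have h4 := Finset.add_sum_erase Finset.univ (fun j => Real.log p + Real.log (1 + b j))
      (Finset.mem_univ m)
    have h5 : ∑ j, (Real.log p + Real.log (1 + b j))
        - ∑ j, (Real.log p + Real.log (b j) - Real.log M) ≤ logBound b := by
      rw [← Finset.sum_sub_distrib]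
      refine Finset.sum_le_sum fun j _ => ?_
      have := log_one_add_le (hb j)
      have := neg_abs_le (Real.log (b j))
      linarith
    have h6 : 0 ≤ Real.log (1 + b m) := Real.log_nonneg (by linarith [hb m])
    linarith
  · have h1 := hup m
    have h2 := log_one_add_le (hb m)
    have h3 := le_logBound b m
    have h4 := abs_nonneg (Real.log (b m))
    linarith

/-- The ratio `(1 + a x) / (1 + c x)` lies between `1` and `a / c`. This transfers the bound from
the gains of one service to those of the other. -/
theorem abs_log_sub_log_le {a c x : ℝ} (ha : 0 < a) (hc : 0 < c) (hx : 0 ≤ x) :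
    |Real.log (1 + a * x) - Real.log (1 + c * x)| ≤ |Real.log a| + |Real.log c| := by
  have key : ∀ {a c : ℝ}, 0 < a → 0 < c →
      Real.log (1 + a * x) - Real.log (1 + c * x) ≤ |Real.log a| + |Real.log c| := by
    intro a c ha hc
    rcases le_total a c with h | h
    · have : Real.log (1 + a * x) ≤ Real.log (1 + c * x) :=
        Real.log_le_log (by positivity) (by gcongr)
      have := abs_nonneg (Real.log a)
      have := abs_nonneg (Real.log c)
      linarith
    · have h1 : Real.log (1 + a * x) ≤ Real.log (a / c * (1 + c * x)) := by
        refine Real.log_le_log (by positivity) ?_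
        have h2 : 1 ≤ a / c := (one_le_div hc).2 h
        have h3 : a / c * (1 + c * x) = a / c + a * x := by field_simp
        linarith
      rw [Real.log_mul (by positivity) (by positivity), Real.log_div ha.ne' hc.ne'] at h1
      have := le_abs_self (Real.log a)
      have := neg_abs_le (Real.log c)
      linarith
  rw [abs_le]
  constructor
  · have := key hc ha
    linarith
  · exact key ha hc

theorem abs_log_one_add_sub_le_of_le {a : Fin M → ℝ} (hM : 0 < M) (ha : ∀ m, 0 < a m)
    (hb : ∀ m, 0 < b m) (hp : 1 ≤ p) (hq : q ∈ powerSimplex M p)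
    (hle : sumRate b (fun _ => p / M) ≤ sumRate b q) (m : Fin M) :
    |Real.log (1 + a m * q m) - Real.log p| ≤ |Real.log (a m)| + 2 * logBound b := by
  have h1 := abs_log_one_add_sub_le_logBound hM hb hp hq hle m
  have h2 := abs_log_sub_log_le (ha m) (hb m) (hq.2 m)
  have h3 := le_logBound b m
  have h4 := abs_nonneg (Real.log (b m))
  have h5 : (0 : ℝ) < Real.log 2 := Real.log_pos one_lt_two
  have h6 := Real.log_natCast_nonneg M
  have h7 := abs_sub_le (Real.log (1 + a m * q m)) (Real.log (1 + b m * q m)) (Real.log p)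
  linarith

end

/-! ### Optimal power allocations of parallel channels -/

section
variable {M : ℕ} {a c : Fin M → ℝ} {A α p : ℝ}

theorem existsUnique_isOptimal (hA : 0 < A) (ha : ∀ m, 0 < a m) (hc : ∀ m, 0 < c m)
    (hα : α ∈ Set.Icc (0 : ℝ) 1) (hp : 0 ≤ p) :
    ∃! q, IsOptimal (fun q => A * sumRate a q) (sumRate c) α p q := by
  have h1 : ∀ q ∈ powerSimplex M p, 0 ≤ A * sumRate a q := fun q hq =>
    mul_nonneg hA.le (sumRate_nonneg ha hq.2)
  have h2 : ∀ q ∈ powerSimplex M p, 0 ≤ sumRate c q := fun q hq => sumRate_nonneg hc hq.2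
  obtain ⟨q, hq⟩ := exists_isOptimal hα hp h1 h2
    ((continuousOn_sumRate a ha p).const_mul A) (continuousOn_sumRate c hc p)
  refine ⟨q, hq, fun q' hq' => isOptimal_unique hα h1 h2 ?_ ?_ hq' hq⟩
  · intro q₁ hq₁ q₂ hq₂ hne
    rw [← mul_min_of_nonneg _ _ hA.le]
    exact mul_lt_mul_of_pos_left (min_sumRate_lt_midpoint ha hq₁.2 hq₂.2 hne) hA
  · intro q₁ hq₁ q₂ hq₂ hne
    exact min_sumRate_lt_midpoint hc hq₁.2 hq₂.2 hne

theorem isOptimal_mem_and_le (hM : 0 < M) (hA : 0 < A) (ha : ∀ m, 0 < a m) (hc : ∀ m, 0 < c m)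
    (hα : α ∈ Set.Icc (0 : ℝ) 1) (hp : 0 ≤ p) {q : Fin M → ℝ}
    (hq : IsOptimal (fun q => A * sumRate a q) (sumRate c) α p q) :
    q ∈ powerSimplex M p ∧ (sumRate a (fun _ => p / M) ≤ sumRate a q ∨
      sumRate c (fun _ => p / M) ≤ sumRate c q) := by
  have h1 : ∀ q ∈ powerSimplex M p, 0 ≤ A * sumRate a q := fun q hq =>
    mul_nonneg hA.le (sumRate_nonneg ha hq.2)
  have h2 : ∀ q ∈ powerSimplex M p, 0 ≤ sumRate c q := fun q hq => sumRate_nonneg hc hq.2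
  refine ⟨((isOptimal_iff hα h1 h2 q).1 hq).1, ?_⟩
  exact (hq.le_or_le hα h1 h2 (uniform_mem_powerSimplex hM hp)).imp_left fun h =>
    le_of_mul_le_mul_left h hA

/-- Exponentiated gains and truncated powers make the sum rate continuous on a whole vector space,
with no domain restriction. -/
theorem continuous_sumRate_exp_max (M : ℕ) : Continuous
    (fun x : (Fin M → ℝ) × (Fin M → ℝ) =>
      sumRate (fun m => Real.exp (x.1 m)) (fun m => max (x.2 m) 0)) := by
  simp only [sumRate_eq_log]
  refine Continuous.div_const (continuous_finsetSum _ fun m _ => ?_) _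
  refine Continuous.log (by fun_prop) fun x => ?_
  have := mul_nonneg (Real.exp_pos (x.1 m)).le (le_max_right (x.2 m) 0)
  linarith

/-- The optimal power allocation depends continuously on the logarithms of the gains. -/
theorem exists_continuous_isOptimal (hA : 0 < A) (ha : ∀ m, 0 < a m)
    (hα : α ∈ Set.Icc (0 : ℝ) 1) (hp : 0 ≤ p) :
    ∃ Q : (Fin M → ℝ) → (Fin M → ℝ), Continuous Q ∧ ∀ x,
      IsOptimal (fun q => A * sumRate a q) (sumRate fun m => Real.exp (x m)) α p (Q x) := by
  have hex := fun x : Fin M → ℝ => existsUnique_isOptimal (c := fun m => Real.exp (x m)) hA ha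
    (fun m => Real.exp_pos _) hα hp
  choose Q hQ hQu using hex
  have h1 : ∀ q ∈ powerSimplex M p, 0 ≤ A * sumRate a q := fun q hq =>
    mul_nonneg hA.le (sumRate_nonneg ha hq.2)
  have h2 : ∀ x : Fin M → ℝ, ∀ q ∈ powerSimplex M p, 0 ≤ sumRate (fun m => Real.exp (x m)) q :=
    fun x q hq => sumRate_nonneg (fun m => Real.exp_pos _) hq.2
  set G : (Fin M → ℝ) × (Fin M → ℝ) → ℝ := fun x =>
    profile α (A * sumRate (fun m => Real.exp (Real.log (a m))) (fun m => max (x.2 m) 0))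
      (sumRate (fun m => Real.exp (x.1 m)) (fun m => max (x.2 m) 0)) with hG
  have hGc : Continuous G := by
    refine (continuous_profile α).comp (Continuous.prodMk ?_ (continuous_sumRate_exp_max M))
    exact ((continuous_sumRate_exp_max M).comp
      (continuous_const.prodMk continuous_snd)).const_mul A
  have hGeq : ∀ x, ∀ q ∈ powerSimplex M p,
      G (x, q) = profile α (A * sumRate a q) (sumRate (fun m => Real.exp (x m)) q) := by
    intro x q hq
    have : (fun m => max (q m) 0) = q := funext fun m => max_eq_left (hq.2 m)
    have ha' : (fun m => Real.exp (Real.log (a m))) = a := funext fun m => Real.exp_log (ha m)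
    simp only [hG, this, ha']
  have hmax : ∀ x, Q x ∈ powerSimplex M p ∧
      ∀ q' ∈ powerSimplex M p, G (x, q') ≤ G (x, Q x) := by
    intro x
    have h := (isOptimal_iff hα h1 (h2 x) (Q x)).1 (hQ x)
    refine ⟨h.1, fun q' hq' => ?_⟩
    rw [hGeq x q' hq', hGeq x _ h.1]
    exact h.2 q' hq'
  refine ⟨Q, continuous_iff_continuousAt.2 fun x₀ => ?_, hQ⟩
  -- Berge's argument: the maximizers stay in a compact set, so it is enough that each of their
  -- cluster points is the unique maximizer at `x₀`. A better competitor there would, by joint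
  -- continuity, also beat some nearby maximizer.
  refine (isCompact_powerSimplex M p).tendsto_nhds_of_unique_mapClusterPt
    (Eventually.of_forall fun x => (hmax x).1) fun q hq hclus => ?_
  refine hQu x₀ q ((isOptimal_iff hα h1 (h2 x₀) q).2 ⟨hq, fun q' hq' => ?_⟩)
  rw [← hGeq x₀ q' hq', ← hGeq x₀ q hq]
  by_contra! hlt
  have hopen : IsOpen {x : (Fin M → ℝ) × (Fin M → ℝ) | G x < G (x.1, q')} :=
    isOpen_lt hGc (hGc.comp (continuous_fst.prodMk continuous_const))
  obtain ⟨V, hV, W, hW, hVW⟩ := mem_nhds_prod_iff.1 (hopen.mem_nhds (x := (x₀, q)) hlt)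
  obtain ⟨x, hxW, hxV⟩ := ((mapClusterPt_iff_frequently.1 hclus W hW).and_eventually hV).exists
  have : G (x, Q x) < G (x, q') := hVW (Set.mk_mem_prod hxV hxW)
  exact absurd ((hmax x).2 q' hq') (not_le.2 this)

end

/-! ### Mean rates at high power -/

section
variable {Ω : Type*} [MeasurableSpace Ω] {μ : Measure Ω} {M : ℕ}
  {d : Ω → Fin M → ℝ} {q : Ω → Fin M → ℝ}

theorem aestronglyMeasurable_log_rate (hdm : ∀ m, AEMeasurable (fun ω => d ω m) μ)
    (hqm : AEMeasurable q μ) (m : Fin M) :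
    AEStronglyMeasurable (fun ω => Real.log (1 + d ω m * q ω m)) μ := by
  have hq' : AEMeasurable (fun ω => q ω m) μ := (measurable_pi_apply m).comp_aemeasurable hqm
  exact (Real.measurable_log.comp_aemeasurable
    (((hdm m).mul hq').const_add 1)).aestronglyMeasurable

variable [IsProbabilityMeasure μ]

theorem integrable_log_rate (hd : ∀ᵐ ω ∂μ, ∀ m, 0 < d ω m)
    (hdm : ∀ m, AEMeasurable (fun ω => d ω m) μ)
    (hlog : ∀ m, Integrable (fun ω => Real.log (d ω m)) μ) (hqm : AEMeasurable q μ) {p : ℝ}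
    (hp : 0 < p) (hq : ∀ᵐ ω ∂μ, q ω ∈ powerSimplex M p) (m : Fin M) :
    Integrable (fun ω => Real.log (1 + d ω m * q ω m)) μ := by
  have hb : Integrable (fun ω => Real.log 2 + (|Real.log (d ω m)| + |Real.log p|)) μ :=
    (integrable_const _).add ((hlog m).abs.add (integrable_const _))
  refine hb.mono' (aestronglyMeasurable_log_rate hdm hqm m) ?_
  filter_upwards [hd, hq] with ω hdω hqω
  have h1 := one_le_one_add_mul hdω hqω.2 m
  rw [Real.norm_eq_abs, abs_of_nonneg (Real.log_nonneg h1)]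
  have h2 : Real.log (1 + d ω m * q ω m) ≤ Real.log (1 + d ω m * p) := by
    refine Real.log_le_log (by linarith) ?_
    have := mul_le_mul_of_nonneg_left (le_of_mem_powerSimplex hqω m) (hdω m).le
    linarith
  have h3 := log_one_add_le (mul_pos (hdω m) hp)
  rw [Real.log_mul (hdω m).ne' hp.ne'] at h3
  have h4 := abs_add_le (Real.log (d ω m)) (Real.log p)
  linarith

theorem integrable_logBound {c : Ω → Fin M → ℝ}
    (hlogc : ∀ m, Integrable (fun ω => Real.log (c ω m)) μ) :
    Integrable (fun ω => logBound (c ω)) μ := by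
  unfold logBound
  exact integrable_finsetSum _ fun m _ =>
    (((hlogc m).abs.const_mul 2).add (integrable_const _)).add (integrable_const _)

theorem logBound_nonneg (b : Fin M → ℝ) : 0 ≤ logBound b :=
  Finset.sum_nonneg fun j _ => logBound_term_nonneg b j

/-- The gains `d` are kept separate from `a` and `c`: the theorem takes `d = a` for sensing and `d =
c` for communication, whichever comparison with uniform holds. -/
theorem tendsto_integral_log_rate (hM : 0 < M) {a : Fin M → ℝ} (ha : ∀ m, 0 < a m)
    {c : Ω → Fin M → ℝ} (hc : ∀ᵐ ω ∂μ, ∀ m, 0 < c ω m)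
    (hlogc : ∀ m, Integrable (fun ω => Real.log (c ω m)) μ)
    (hd : ∀ᵐ ω ∂μ, ∀ m, 0 < d ω m) (hdm : ∀ m, AEMeasurable (fun ω => d ω m) μ)
    (hlog : ∀ m, Integrable (fun ω => Real.log (d ω m)) μ)
    {q : ℝ → Ω → Fin M → ℝ} (hqm : ∀ p, 0 < p → AEMeasurable (q p) μ)
    (hq : ∀ᵐ ω ∂μ, ∀ p, 0 < p → q p ω ∈ powerSimplex M p ∧
      (sumRate a (fun _ => p / M) ≤ sumRate a (q p ω) ∨
        sumRate (c ω) (fun _ => p / M) ≤ sumRate (c ω) (q p ω))) (m : Fin M) :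
    Tendsto (fun p => (∫ ω, Real.log (1 + d ω m * q p ω m) ∂μ) - Real.log p) atTop
      (𝓝 ((∫ ω, Real.log (d ω m) ∂μ) - Real.log M)) := by
  have hM' : (0 : ℝ) < M := by exact_mod_cast hM
  have hint : ∀ p, 0 < p → Integrable (fun ω => Real.log (1 + d ω m * q p ω m)) μ := fun p hp =>
    integrable_log_rate hd hdm hlog (hqm p hp) hp (hq.mono fun ω h => (h p hp).1) m
  have hlim : Tendsto (fun p => ∫ ω, (Real.log (1 + d ω m * q p ω m) - Real.log p) ∂μ) atTop
      (𝓝 (∫ ω, (Real.log (d ω m) - Real.log M) ∂μ)) := by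
    refine tendsto_integral_filter_of_dominated_convergence
      -- Which alternative holds may change with `p` and `ω`, so the bounds of both cases are added;
      -- likewise the two power errors below.
      (fun ω => |Real.log (d ω m)| + (2 * logBound a + 2 * logBound (c ω))) ?_ ?_ ?_ ?_
    · filter_upwards [eventually_gt_atTop 0] with p hp
      exact (aestronglyMeasurable_log_rate hdm (hqm p hp) m).sub aestronglyMeasurable_const
    · filter_upwards [eventually_ge_atTop 1] with p hp
      filter_upwards [hc, hd, hq] with ω hcω hdω hqω
      have hp0 : 0 < p := by linarith
      rw [Real.norm_eq_abs]
      have h1 := logBound_nonneg a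
      have h2 := logBound_nonneg (c ω)
      rcases (hqω p hp0).2 with h | h
      · have := abs_log_one_add_sub_le_of_le hM hdω ha hp (hqω p hp0).1 h m
        linarith
      · have := abs_log_one_add_sub_le_of_le hM hdω hcω hp (hqω p hp0).1 h m
        linarith
    · exact (hlog m).abs.add
        ((integrable_const _).add ((integrable_logBound hlogc).const_mul 2))
    · filter_upwards [hc, hd, hq] with ω hcω hdω hqω
      have hratio : Tendsto (fun p => q p ω m / p) atTop (𝓝 (1 / (M : ℝ))) := by
        rw [tendsto_iff_dist_tendsto_zero]
        have herr := (tendsto_powerError a m).add (tendsto_powerError (c ω) m)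
        rw [add_zero] at herr
        refine squeeze_zero' (Eventually.of_forall fun p => dist_nonneg) ?_ herr
        filter_upwards [eventually_gt_atTop 0] with p hp
        rw [Real.dist_eq]
        have h1 := powerError_nonneg ha hp m
        have h2 := powerError_nonneg hcω hp m
        rcases (hqω p hp).2 with h | h
        · have := abs_div_sub_le_powerError hM ha hp (hqω p hp).1 h m
          linarith
        · have := abs_div_sub_le_powerError hM hcω hp (hqω p hp).1 h m
          linarith
      have hone : Tendsto (fun p : ℝ => 1 / p + d ω m * (q p ω m / p)) atTop
          (𝓝 (0 + d ω m * (1 / (M : ℝ)))) :=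
        (tendsto_const_nhds.div_atTop tendsto_id).add (hratio.const_mul _)
      have hpos : 0 + d ω m * (1 / (M : ℝ)) ≠ 0 := by have := hdω m; positivity
      have hl := hone.log hpos
      rw [show (0 + d ω m * (1 / (M : ℝ))) = d ω m / M by ring,
        Real.log_div (hdω m).ne' hM'.ne'] at hl
      refine hl.congr' ?_
      filter_upwards [eventually_gt_atTop 0] with p hp
      have h1 := one_le_one_add_mul hdω (hqω p hp).1.2 m
      rw [← Real.log_div (by linarith) hp.ne']
      congr 1
      field_simp
  rw [integral_sub (hlog m) (integrable_const _)] at hlim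
  simp only [integral_const, probReal_univ, one_smul] at hlim
  refine hlim.congr' ?_
  filter_upwards [eventually_gt_atTop 0] with p hp
  rw [integral_sub (hint p hp) (integrable_const _)]
  simp

end

theorem pos_of_posDef_eigendecomposition {M : ℕ} {R U : Matrix (Fin M) (Fin M) ℂ}
    (hR : R.PosDef) (hU : U ∈ Matrix.unitaryGroup (Fin M) ℂ) {lam : Fin M → ℝ}
    (hRU : R = U * Matrix.diagonal (fun m => (lam m : ℂ)) * Uᴴ) (m : Fin M) : 0 < lam m := by
  have hUU : Uᴴ * U = 1 := Matrix.mem_unitaryGroup_iff'.1 hU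
  have hinj : Function.Injective U.mulVec := by
    intro x y h
    have := congrArg (Uᴴ *ᵥ ·) h
    simpa [Matrix.mulVec_mulVec, hUU] using this
  have h := hR.conjTranspose_mul_mul_same hinj
  have hd : Uᴴ * R * U = Matrix.diagonal (fun m => (lam m : ℂ)) := by
    rw [hRU]
    calc _ = (Uᴴ * U) * Matrix.diagonal (fun m => (lam m : ℂ)) * (Uᴴ * U) := by
          simp only [Matrix.mul_assoc]
      _ = _ := by rw [hUU, Matrix.one_mul, Matrix.mul_one]
  rw [hd, Matrix.posDef_diagonal_iff] at h
  exact_mod_cast h m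

theorem optimalPower_spec {M : ℕ} {Rs Rc : (Fin M → ℝ) → ℝ} {α p : ℝ}
    (h : ∃ q, IsOptimal Rs Rc α p q) : IsOptimal Rs Rc α p (optimalPower Rs Rc α p) := by
  unfold optimalPower
  rw [dif_pos h]
  exact h.choose_spec

/-! ### Average rates of near-uniform power allocations -/

section
variable {Ω : Type*} [MeasurableSpace Ω] {μ : Measure Ω} [IsProbabilityMeasure μ] {M : ℕ}
  {d : Ω → Fin M → ℝ}

theorem integrable_sumRate {q : Ω → Fin M → ℝ} (hd : ∀ᵐ ω ∂μ, ∀ m, 0 < d ω m)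
    (hdm : ∀ m, AEMeasurable (fun ω => d ω m) μ)
    (hlog : ∀ m, Integrable (fun ω => Real.log (d ω m)) μ) (hqm : AEMeasurable q μ) {p : ℝ}
    (hp : 0 < p) (hq : ∀ᵐ ω ∂μ, q ω ∈ powerSimplex M p) :
    Integrable (fun ω => sumRate (d ω) (q ω)) μ := by
  simp only [sumRate_eq_log]
  exact (integrable_finsetSum _ fun m _ =>
    integrable_log_rate hd hdm hlog hqm hp hq m).div_const _

theorem tendsto_integral_sumRate (hM : 0 < M) {a : Fin M → ℝ} (ha : ∀ m, 0 < a m)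
    {c : Ω → Fin M → ℝ} (hc : ∀ᵐ ω ∂μ, ∀ m, 0 < c ω m)
    (hlogc : ∀ m, Integrable (fun ω => Real.log (c ω m)) μ)
    (hd : ∀ᵐ ω ∂μ, ∀ m, 0 < d ω m) (hdm : ∀ m, AEMeasurable (fun ω => d ω m) μ)
    (hlog : ∀ m, Integrable (fun ω => Real.log (d ω m)) μ)
    {q : ℝ → Ω → Fin M → ℝ} (hqm : ∀ p, 0 < p → AEMeasurable (q p) μ)
    (hq : ∀ᵐ ω ∂μ, ∀ p, 0 < p → q p ω ∈ powerSimplex M p ∧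
      (sumRate a (fun _ => p / M) ≤ sumRate a (q p ω) ∨
        sumRate (c ω) (fun _ => p / M) ≤ sumRate (c ω) (q p ω))) :
    Tendsto (fun p => (∫ ω, sumRate (d ω) (q p ω) ∂μ) -
      ∑ m, (Real.logb 2 p + ((∫ ω, Real.log (d ω m) ∂μ) - Real.log M) / Real.log 2))
      atTop (𝓝 0) := by
  have h := tendsto_finsetSum Finset.univ fun m _ =>
    ((tendsto_integral_log_rate hM ha hc hlogc hd hdm hlog hqm hq m).sub_const
      ((∫ ω, Real.log (d ω m) ∂μ) - Real.log M)).div_const (Real.log 2)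
  simp only [sub_self, zero_div, Finset.sum_const_zero] at h
  refine h.congr' ?_
  filter_upwards [eventually_gt_atTop 0] with p hp
  simp only [sumRate_eq_log]
  rw [integral_div, integral_finsetSum _ fun m _ => integrable_log_rate hd hdm hlog (hqm p hp) hp
    (hq.mono fun ω h => (h p hp).1) m, Finset.sum_div, ← Finset.sum_sub_distrib]
  refine Finset.sum_congr rfl fun m _ => ?_
  rw [← Real.log_div_log]
  ring

end

end ISAC

/-! ### Assembly of the high-power asymptotics -/

theorem corollary1 {Ω : Type*} [MeasurableSpace Ω] (μ : Measure Ω) [IsProbabilityMeasure μ]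
    {K M N L : ℕ} (hM : 0 < M) (hN : 0 < N) (hL : 0 < L) (hKM : M ≤ K)
    -- target correlation matrix, with an eigendecomposition
    (R : Matrix (Fin M) (Fin M) ℂ) (hR : R.PosDef)
    (U : Matrix (Fin M) (Fin M) ℂ) (hU : U ∈ Matrix.unitaryGroup (Fin M) ℂ)
    (lam : Fin M → ℝ) (hRU : R = U * Matrix.diagonal (fun m => (lam m : ℂ)) * Uᴴ)
    -- orthogonal unit-power data streams
    (S : Matrix (Fin M) (Fin L) ℂ) (hS : S * Sᴴ = (L : ℂ) • (1 : Matrix (Fin M) (Fin M) ℂ))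
    -- Rayleigh fading channels of the users
    (H : Fin M → Ω → Matrix (Fin K) (Fin M) ℂ)
    (hHlaw : ∀ m k j, HasLaw (fun ω => H m ω k j) ISAC.stdCN μ)
    (hHind : ∀ m, iIndepFun (fun (i : Fin K × Fin M) ω => H m ω i.1 i.2) μ)
    -- rate-profile parameter
    (α : ℝ) (hα : α ∈ Set.Icc (0 : ℝ) 1) :
    -- the rate-profile problem determines the optimal precoder, and the mean rates exist
    (∀ p : ℝ, 0 < p →
      (∀ᵐ ω ∂μ, ∃! q : Fin M → ℝ,
        ISAC.IsOptimal (ISAC.SR N R U S) (ISAC.CR (fun m => H m ω) U) α p q) ∧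
      Integrable (fun ω => ISAC.instSR N R U S α p (fun m => H m ω)) μ ∧
      Integrable (fun ω => ISAC.instCR N R U S α p (fun m => H m ω)) μ) ∧
    -- average sensing rate at high SNR
    Tendsto (fun p : ℝ =>
        (∫ ω, ISAC.instSR N R U S α p (fun m => H m ω) ∂μ) -
          (N : ℝ) * M / L *
            (Real.logb 2 p + 1 / (M : ℝ) * ∑ m, Real.logb 2 ((L : ℝ) * lam m / M)))
      atTop (𝓝 0) ∧
    -- ergodic sum communication rate at high SNR
    Tendsto (fun p : ℝ =>
        (∫ ω, ISAC.instCR N R U S α p (fun m => H m ω) ∂μ) -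
          (M : ℝ) * (Real.logb 2 p - Real.logb 2 M +
            ISAC.digamma ((K : ℝ) - M + 1) / Real.log 2))
      atTop (𝓝 0) := by
  have hlam := ISAC.pos_of_posDef_eigendecomposition hR hU hRU
  have hM' : (0 : ℝ) < M := by exact_mod_cast hM
  have hL' : (0 : ℝ) < L := by exact_mod_cast hL
  have hA : 0 < (N : ℝ) / L := div_pos (by exact_mod_cast hN) hL'
  have hk : 0 < (K : ℝ) - M + 1 := by
    have : (M : ℝ) ≤ K := by exact_mod_cast hKM
    linarith
  set A : ℝ := (N : ℝ) / L with hAdef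
  set a : Fin M → ℝ := fun m => (L : ℝ) * lam m with hadef
  have ha : ∀ m, 0 < a m := fun m => mul_pos hL' (hlam m)
  set c : Ω → Fin M → ℝ := fun ω m => ISAC.zfGain (H m ω * U) m with hcdef
  have hlaw : ∀ m, HasLaw (fun ω => c ω m) (gammaMeasure ((K : ℝ) - M + 1) 1) μ := fun m =>
    ISAC.hasLaw_zfGain hM hKM hU (hHlaw m) (hHind m) m
  have hcm : ∀ m, AEMeasurable (fun ω => c ω m) μ := fun m => (hlaw m).aemeasurable
  have hc : ∀ᵐ ω ∂μ, ∀ m, 0 < c ω m := ae_all_iff.2 fun m => by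
    have h := ISAC.gammaMeasure_ae_pos hk
    rw [← (hlaw m).map_eq] at h
    exact ae_of_ae_map (hcm m) h
  have hlogc : ∀ m, Integrable (fun ω => Real.log (c ω m)) μ := fun m => by
    have h := ISAC.integrable_log_gammaMeasure hk
    rw [← (hlaw m).map_eq] at h
    exact h.comp_aemeasurable (hcm m)
  have hintc : ∀ m, ∫ ω, Real.log (c ω m) ∂μ = ISAC.digamma ((K : ℝ) - M + 1) := fun m => by
    rw [← ISAC.integral_log_gammaMeasure hk, ← (hlaw m).map_eq,
      integral_map (hcm m) Real.measurable_log.aestronglyMeasurable]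
  have hSR : ∀ q : Fin M → ℝ, (∀ m, 0 ≤ q m) → ISAC.SR N R U S q = A * ISAC.sumRate a q :=
    fun q hq => ISAC.SR_eq hU (fun m => (hlam m).le) hRU hS hq
  have hCR : ∀ ω (q : Fin M → ℝ), ISAC.CR (fun m => H m ω) U q = ISAC.sumRate (c ω) q :=
    fun ω q => ISAC.CR_eq _ U q
  have hopt : ∀ ω p (q : Fin M → ℝ),
      ISAC.IsOptimal (ISAC.SR N R U S) (ISAC.CR (fun m => H m ω) U) α p q ↔
        ISAC.IsOptimal (fun q => A * ISAC.sumRate a q) (ISAC.sumRate (c ω)) α p q :=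
    fun ω p q => ISAC.isOptimal_congr hSR (fun q _ => hCR ω q) α p q
  set q : ℝ → Ω → Fin M → ℝ := fun p ω => ISAC.paretoPower N R U S α p fun m => H m ω with hqdef
  have huniq : ∀ ω, (∀ m, 0 < c ω m) → ∀ p, 0 < p → ∃! q : Fin M → ℝ,
      ISAC.IsOptimal (ISAC.SR N R U S) (ISAC.CR (fun m => H m ω) U) α p q := by
    intro ω hω p hp
    simp only [hopt]
    exact ISAC.existsUnique_isOptimal hA ha hω hα hp.le
  have hspec : ∀ ω, (∀ m, 0 < c ω m) → ∀ p, 0 < p →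
      ISAC.IsOptimal (ISAC.SR N R U S) (ISAC.CR (fun m => H m ω) U) α p (q p ω) :=
    fun ω hω p hp => ISAC.optimalPower_spec (huniq ω hω p hp).exists
  have hq : ∀ᵐ ω ∂μ, ∀ p, 0 < p → q p ω ∈ ISAC.powerSimplex M p ∧
      (ISAC.sumRate a (fun _ => p / M) ≤ ISAC.sumRate a (q p ω) ∨
        ISAC.sumRate (c ω) (fun _ => p / M) ≤ ISAC.sumRate (c ω) (q p ω)) := by
    filter_upwards [hc] with ω hω p hp
    exact ISAC.isOptimal_mem_and_le hM hA ha hω hα hp.le ((hopt ω p _).1 (hspec ω hω p hp))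
  -- The chosen optimizer carries no measurability of its own; almost sure uniqueness equates it
  -- with the continuous selection at the log-gains.
  have hqm : ∀ p, 0 < p → AEMeasurable (q p) μ := by
    intro p hp
    obtain ⟨Q, hQ, hQopt⟩ := ISAC.exists_continuous_isOptimal hA ha hα hp.le
    have hm : AEMeasurable (fun ω => Q fun m => Real.log (c ω m)) μ :=
      hQ.measurable.comp_aemeasurable
        (aemeasurable_pi_lambda _ fun m => Real.measurable_log.comp_aemeasurable (hcm m))
    refine hm.congr ?_
    filter_upwards [hc] with ω hω
    refine (huniq ω hω p hp).unique ((hopt ω p _).2 ?_) (hspec ω hω p hp)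
    have h := hQopt fun m => Real.log (c ω m)
    simpa only [Real.exp_log (hω _)] using h
  have hqs : ∀ p, 0 < p → ∀ᵐ ω ∂μ, q p ω ∈ ISAC.powerSimplex M p := fun p hp =>
    hq.mono fun ω h => (h p hp).1
  have hSRae : ∀ p, 0 < p → (fun ω => A * ISAC.sumRate a (q p ω)) =ᵐ[μ]
      fun ω => ISAC.instSR N R U S α p (fun m => H m ω) := fun p hp => by
    filter_upwards [hqs p hp] with ω hω
    exact (hSR _ hω.2).symm
  have hCRae : ∀ p, (fun ω => ISAC.instCR N R U S α p (fun m => H m ω)) =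
      fun ω => ISAC.sumRate (c ω) (q p ω) := fun p => funext fun ω => hCR ω _
  have hda : ∀ᵐ _ω ∂μ, ∀ m, 0 < a m := Eventually.of_forall fun _ => ha
  refine ⟨fun p hp => ⟨hc.mono fun ω hω => huniq ω hω p hp, ?_, ?_⟩, ?_, ?_⟩
  · exact ((ISAC.integrable_sumRate hda (fun m => aemeasurable_const)
      (fun m => integrable_const _) (hqm p hp) hp (hqs p hp)).const_mul A).congr (hSRae p hp)
  · rw [hCRae]
    exact ISAC.integrable_sumRate hc hcm hlogc (hqm p hp) hp (hqs p hp)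
  · have h := (ISAC.tendsto_integral_sumRate hM ha hc hlogc hda (fun m => aemeasurable_const)
      (fun m => integrable_const _) hqm hq).const_mul A
    rw [mul_zero] at h
    refine h.congr' ?_
    filter_upwards [eventually_gt_atTop 0] with p hp
    rw [← integral_congr_ae (hSRae p hp), integral_const_mul, mul_sub]
    congr 1
    have hterm : ∀ m, (∫ _ω, Real.log (a m) ∂μ - Real.log M) / Real.log 2 =
        Real.logb 2 ((L : ℝ) * lam m / M) := fun m => by
      rw [integral_const, probReal_univ, one_smul, ← Real.log_div (ha m).ne' hM'.ne',
        Real.log_div_log]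
    simp only [hterm]
    rw [Finset.sum_add_distrib, Finset.sum_const, Finset.card_univ, Fintype.card_fin,
      nsmul_eq_mul, hAdef]
    field_simp
  · have h := ISAC.tendsto_integral_sumRate hM ha hc hlogc hc hcm hlogc hqm hq
    refine h.congr fun p => ?_
    rw [hCRae]
    congr 1
    simp only [hintc]
    rw [Finset.sum_const, Finset.card_univ, Fintype.card_fin, nsmul_eq_mul, sub_div,
      Real.log_div_log]
    ring
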